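/- Let $d\ge 1$ and let $\mathbb{T}^d=\mathbb{R}^d/\mathbb{Z}^d$ be the $d$-dimensional torus with its flat (Euclidean) metric. For a nonincreasing sequence $(l_n)$ with $0<l_n\le 1/2$, let $g_n=B(0,l_n/2)$ be the closed ball of diameter $l_n$ centred at $0$ in $\mathbb{T}^d$, put \[\alpha(l_n)=\limsup_{n\to\infty}\frac{\log n}{-\log l_n},\] and, for a sequence $(\xi_n)$ of independent, uniformly distributed random points of $\mathbb{T}^d$, let \[E=\limsup_{n\to\infty}(g_n+\xi_n)=\bigcap_{n}\bigcup_{k\ge n}(g_k+\xi_k)\] be the random set of points covered infinitely often. Let $\dim_H$ and $\dim_P$ denote Hausdorff and packing dimension. For all real $\alpha,t$ with $0\le\alpha\le d$ and $0\le t\le d$ there are a sequence $(l_n)$ as above with $\alpha(l_n)=\alpha$ and a closed set $F\subset\mathbb{T}^d$ with $\dim_H F=t$ and $\dim_P F=d$ such that, almost surely, $\dim_H(E\cap F)=\min\{\alpha,t\}$. In particular, there are $\alpha\in[0,d]$, a sequence $(l_n)$ as above with $\alpha(l_n)=\alpha$, and a closed set $F\subset\mathbb{T}^d$ such that, almost surely,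 \[\dim_H F+\alpha-d<\dim_H(E\cap F)<\dim_P F+\alpha-d.\] -/

import Mathlib

open Set Filter Topology MeasureTheory ProbabilityTheory
open scoped ENNReal NNReal

universe u

/-- The `d`-dimensional flat torus `ℝ^d / ℤ^d` with its Euclidean quotient metric. -/
abbrev Torus (d : ℕ) : Type := PiLp 2 (fun _ : Fin d => UnitAddCircle)

/-- The uniform distribution (normalized Lebesgue measure) on the torus. -/
noncomputable def torusUniform (d : ℕ) : Measure (Torus d) :=
  (volume : Measure (Fin d → UnitAddCircle)).map (WithLp.toLp 2)

/-- `ξ` is a sequence of independent, uniformly distributed random points of the torus. -/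
structure IsIndepUniform {d : ℕ} {Ω : Type u} [MeasurableSpace Ω] (ξ : ℕ → Ω → Torus d)
    (P : Measure Ω) : Prop where
  measurable : ∀ n, Measurable (ξ n)
  map_eq : ∀ n, P.map (ξ n) = torusUniform d
  indep : iIndepFun ξ P

/-- Admissible diameters: a positive, nonincreasing sequence. The bound `1 / 2` makes
`l n` the diameter of the ball of radius `l n / 2` in the torus (of dimension `d ≥ 1`). -/
structure IsDiameterSeq (l : ℕ → ℝ) : Prop where
  pos : ∀ n, 0 < l n
  le_half : ∀ n, l n ≤ 1 / 2
  antitone : Antitone l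

/-- The exponent `α(l) = limsup log n / (- log l_n)`, as an extended real number. -/
noncomputable def coveringExponent (l : ℕ → ℝ) : EReal :=
  limsup (fun n : ℕ => ((Real.log (n : ℝ) / (-Real.log (l n)) : ℝ) : EReal)) atTop

/-- The random covering set: the set of points covered by infinitely many of the balls of
diameter `l n` centred at `ξ n ω`, that is, of the translates by `ξ n ω` of the balls of
diameter `l n` centred at `0`. -/
def coveringSet {d : ℕ} {Ω : Type u} (l : ℕ → ℝ) (ξ : ℕ → Ω → Torus d) (ω : Ω) :
    Set (Torus d) :=
  ⋂ n : ℕ, ⋃ k ≥ n, Metric.closedBall (ξ k ω) (l k / 2)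

/-- The upper Minkowski (box-counting) dimension `limsup_{r → 0} log N(A, r) / (- log r)`,
where `N(A, r)` is the least number of closed balls of radius `r` covering `A`, with centres
in `A`. The empty set has dimension `0`. -/
noncomputable def upperBoxDim {X : Type*} [PseudoMetricSpace X] (A : Set X) : ℝ≥0∞ :=
  limsup (fun r : ℝ≥0 =>
    (ENNReal.log (Metric.coveringNumber r A : ℝ≥0∞) /
      ((-Real.log (r : ℝ) : ℝ) : EReal)).toENNReal) (𝓝[>] 0)

/-- The packing dimension: the infimum, over all countable covers of `F`, of the supremum of
the upper Minkowski dimensions of the pieces. -/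
noncomputable def dimP {X : Type*} [PseudoMetricSpace X] (F : Set X) : ℝ≥0∞ :=
  ⨅ (A : ℕ → Set X) (_ : F ⊆ ⋃ i, A i), ⨆ i, upperBoxDim (A i)

/-! Write `θ = t / d`, `γ = α / d`, and code points of the torus by sequences of binary digit
vectors. Fix levels `a k`, `b k` with `a k` much smaller than `b k`, and `b k` much smaller than `a
(k + 1)`. The set `F` is `cantorTorus`: a digit vector is free on a set of levels of density `θ` and
on every window `[a k, b k)`, and is zero elsewhere. Just before `a (k + 1)` the proportion of free
levels is close to `θ`, which gives Hausdorff dimension `d * θ`; at `b k` it is close to `1`, which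
gives packing dimension `d`.

The diameters are comparable to `2 ^ (-b k)` on the `k`-th block of indices, whose length is `2 ^ (d
* c k)` up to a factor linear in `b k`, with `c k = ⌊γ * b k⌋₊`; hence the exponent is `d * γ = α`.
The linear factor makes Borel–Cantelli work: almost surely, for all large `k`, every dyadic cell of
level `c k` contains a centre from block `k` (`ae_eventually_forall_exists_mem_dyadicCell`).

For such an outcome, build points of `E ∩ F` by choosing free digits at will, except that the digits
in `[c k, b k)` are copied from a centre lying in the cell reached so far
(`exists_measurable_steering`). The point is then covered in every late block, and it stays in `F`
because `[c k, b k)` lies inside the full window. The levels left free have lower density at least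
`min γ θ` (`le_countBelow_remainingLevels`), so the mass distribution principle gives dimension at
least `d * ρ` for each `ρ < min γ θ`. The upper bound combines `dim F ≤ t` with the deterministic
bound `dim E ≤ α`. -/

/-! ### Binary digits and the coding of the torus -/

/-- The integer formed by the first `n` binary digits. -/
def prefixValue (y : ℕ → Fin 2) : ℕ → ℕ
  | 0 => 0
  | n + 1 => 2 * prefixValue y n + y n

lemma prefixValue_lt (y : ℕ → Fin 2) (n : ℕ) : prefixValue y n < 2 ^ n := by
  induction n with
  | zero => simp [prefixValue]
  | succ n ih =>
    have := (y n).isLt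
    simp only [prefixValue, pow_succ]
    omega

lemma eq_of_prefixValue_eq {y y' : ℕ → Fin 2} {n : ℕ} (h : prefixValue y n = prefixValue y' n) :
    ∀ m < n, y m = y' m := by
  induction n with
  | zero => simp
  | succ n ih =>
    have h1 := (y n).isLt
    have h2 := (y' n).isLt
    simp only [prefixValue] at h
    intro m hm
    rcases Nat.lt_succ_iff_lt_or_eq.mp hm with hm | rfl
    · exact ih (by omega) m hm
    · apply Fin.ext; omega

lemma prefixValue_eq_sum (y : ℕ → Fin 2) (n : ℕ) :
    (prefixValue y n : ℝ) = 2 ^ n * ∑ i ∈ Finset.range n, Real.ofDigitsTerm y i := by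
  induction n with
  | zero => simp [prefixValue]
  | succ n ih =>
    rw [Finset.sum_range_succ, mul_add, pow_succ']
    simp only [prefixValue]
    push_cast
    rw [ih, Real.ofDigitsTerm]
    push_cast
    field_simp
    ring

lemma two_pow_mul_ofDigits (y : ℕ → Fin 2) (n : ℕ) :
    2 ^ n * Real.ofDigits y = prefixValue y n + Real.ofDigits (fun i => y (i + n)) := by
  rw [Real.ofDigits_eq_sum_add_ofDigits y n, prefixValue_eq_sum]
  push_cast
  field_simp

/-- After scaling by `2 ^ n` the points differ by at most `1` modulo `2 ^ n`, and the two tails,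
both in `[0, 1]`, change this by at most `1`. The remainder modulo `2 ^ n` accounts for wrapping
around the circle. -/
lemma prefixValue_of_near {y y' : ℕ → Fin 2} {n : ℕ}
    (h : ‖((Real.ofDigits y : ℝ) : UnitAddCircle) - ((Real.ofDigits y' : ℝ) : UnitAddCircle)‖
      ≤ (2 ^ n)⁻¹) :
    ∃ j ∈ Finset.Icc (-2 : ℤ) 2, (prefixValue y n : ℤ) = (prefixValue y' n + j) % 2 ^ n := by
  rw [← AddCircle.coe_sub, UnitAddCircle.norm_eq] at h
  set r := round (Real.ofDigits y - Real.ofDigits y')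
  have h0 := Real.ofDigits_nonneg (fun i => y (i + n))
  have h1 := Real.ofDigits_le_one (fun i => y (i + n))
  have h0' := Real.ofDigits_nonneg (fun i => y' (i + n))
  have h1' := Real.ofDigits_le_one (fun i => y' (i + n))
  have e := two_pow_mul_ofDigits y n
  have e' := two_pow_mul_ofDigits y' n
  have hp : (0 : ℝ) < 2 ^ n := by positivity
  have key : |(2:ℝ) ^ n * (Real.ofDigits y - Real.ofDigits y' - r)| ≤ 1 := by
    rw [abs_mul, abs_of_pos hp]
    calc _ ≤ (2:ℝ) ^ n * (2 ^ n)⁻¹ := by gcongr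
      _ = 1 := by field_simp
  rw [abs_le] at key
  refine ⟨prefixValue y n - prefixValue y' n - r * 2 ^ n, ?_, ?_⟩
  · rw [Finset.mem_Icc]
    constructor
    · have : ((-2 : ℤ) : ℝ) ≤ ((prefixValue y n - prefixValue y' n - r * 2 ^ n : ℤ) : ℝ) := by
        push_cast; nlinarith
      exact_mod_cast this
    · have : ((prefixValue y n - prefixValue y' n - r * 2 ^ n : ℤ) : ℝ) ≤ ((2 : ℤ) : ℝ) := by
        push_cast; nlinarith
      exact_mod_cast this
  · have hl : (prefixValue y n : ℤ) < 2 ^ n := by exact_mod_cast prefixValue_lt y n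
    rw [show (prefixValue y' n + (prefixValue y n - prefixValue y' n - r * 2 ^ n) : ℤ)
      = prefixValue y n + 2 ^ n * (-r) by ring, Int.add_mul_emod_self_left,
      Int.emod_eq_of_lt (by positivity) hl]

/-- The point of the torus with given coordinatewise binary digits. -/
noncomputable def code {d : ℕ} (y : ℕ → Fin d → Fin 2) : Torus d :=
  WithLp.toLp 2 fun i => ((Real.ofDigits fun m => y m i : ℝ) : UnitAddCircle)

lemma continuous_code {d : ℕ} : Continuous (code (d := d)) := by
  refine (PiLp.continuous_toLp 2 _).comp (continuous_pi fun i => ?_)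
  exact (AddCircle.continuous_mk' (1 : ℝ)).comp (Real.continuous_ofDigits.comp (by fun_prop))

lemma Torus.dist_apply_le {d : ℕ} (x y : Torus d) (i : Fin d) : dist (x i) (y i) ≤ dist x y := by
  have := PiLp.lipschitzWith_ofLp 2 (fun _ : Fin d => UnitAddCircle)
  have := this.dist_le_mul x y
  rw [NNReal.coe_one, one_mul] at this
  exact (dist_le_pi_dist _ _ i).trans this

lemma Torus.dist_le {d : ℕ} (x y : Torus d) {r : ℝ} (hr : 0 ≤ r)
    (h : ∀ i, dist (x i) (y i) ≤ r) : dist x y ≤ d * r := by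
  rw [PiLp.dist_eq_of_L2]
  refine Real.sqrt_le_iff.mpr ⟨by positivity, ?_⟩
  calc ∑ i, dist (x i) (y i) ^ 2 ≤ ∑ _i : Fin d, r ^ 2 :=
        Finset.sum_le_sum fun i _ => by gcongr; exact h i
    _ = d * r ^ 2 := by simp
    _ ≤ (d * r) ^ 2 := by
      rw [mul_pow]
      gcongr
      exact_mod_cast Nat.le_self_pow two_ne_zero d

lemma dist_code_le {d : ℕ} {y y' : ℕ → Fin d → Fin 2} {n : ℕ} (h : ∀ m < n, y m = y' m) :
    dist (code y) (code y') ≤ d * (2 ^ n)⁻¹ := by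
  refine Torus.dist_le _ _ (by positivity) fun i => ?_
  simp only [code]
  rw [dist_eq_norm, ← AddCircle.coe_sub]
  refine (QuotientAddGroup.norm_mk_le_norm (S := AddSubgroup.zmultiples (1:ℝ))).trans ?_
  have := Real.abs_ofDigits_sub_ofDigits_le (b := 2) (x := fun m => y m i) (y := fun m => y' m i)
    (n := n) (fun m hm => by rw [h m hm])
  simpa using this

/-- Sequences whose codes are within `2 ^ (-n)` of a given point fall into at most `5 ^ d`
classes according to their first `n` digits. -/
lemma exists_cover_near {d : ℕ} (n : ℕ) (s : Set (Torus d))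
    (hs : ∀ x ∈ s, ∀ y ∈ s, dist x y ≤ (2 ^ n)⁻¹) :
    ∃ W : Finset (ℕ → Fin d → Fin 2), W.card ≤ 5 ^ d ∧
      ∀ y, code y ∈ s → ∃ w ∈ W, ∀ m < n, y m = w m := by
  classical
  by_cases hne : ∃ y₀, code (d := d) y₀ ∈ s
  swap
  · exact ⟨∅, by simp, fun y hy => (hne ⟨y, hy⟩).elim⟩
  obtain ⟨y₀, hy₀⟩ := hne
  let J := Fintype.piFinset fun _ : Fin d => Finset.Icc (-2 : ℤ) 2
  let Q : (Fin d → ℤ) → (ℕ → Fin d → Fin 2) → Prop := fun j y =>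
    ∀ i, (prefixValue (fun m => y m i) n : ℤ) = (prefixValue (fun m => y₀ m i) n + j i) % 2 ^ n
  let f : (Fin d → ℤ) → (ℕ → Fin d → Fin 2) := fun j =>
    if h : ∃ y, Q j y then h.choose else y₀
  refine ⟨J.image f, Finset.card_image_le.trans ?_, fun y hy => ?_⟩
  · simp [J, Fintype.card_piFinset]
  · have : ∀ i, ∃ j ∈ Finset.Icc (-2 : ℤ) 2, (prefixValue (fun m => y m i) n : ℤ)
        = (prefixValue (fun m => y₀ m i) n + j) % 2 ^ n := fun i => by
      apply prefixValue_of_near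
      rw [← dist_eq_norm]
      exact (Torus.dist_apply_le (code y) (code y₀) i).trans (hs _ hy _ hy₀)
    choose j hj hj' using this
    have hQ : ∃ y, Q j y := ⟨y, hj'⟩
    refine ⟨f j, Finset.mem_image_of_mem _ (Fintype.mem_piFinset.mpr hj), ?_⟩
    have hf : Q j (f j) := by simp only [f, dif_pos hQ]; exact hQ.choose_spec
    intro m hm
    funext i
    refine eq_of_prefixValue_eq (y := fun m => y m i) (y' := fun m => f j m i) ?_ m hm
    have := (hj' i).trans (hf i).symm
    exact_mod_cast this

/-- Both end points are allowed because expansions ending in repeated ones are admitted, so the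
digit map is onto the closed unit interval. -/
lemma exists_code_eq_of_near {w : ℕ → Fin 2} {n : ℕ} {p : ℝ} (h0 : (prefixValue w n : ℝ) ≤ 2 ^ n * p)
    (h1 : 2 ^ n * p ≤ prefixValue w n + 1) :
    ∃ y : ℕ → Fin 2, (∀ m < n, y m = w m) ∧ Real.ofDigits y = p := by
  obtain ⟨z, -, hz⟩ := Real.ofDigits_SurjOn (b := 2) one_lt_two
    (show (2 ^ n * p - prefixValue w n : ℝ) ∈ Icc (0:ℝ) 1 from ⟨by linarith, by linarith⟩)
  refine ⟨fun m => if m < n then w m else z (m - n), fun m hm => by simp [hm], ?_⟩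
  have hpre : ∀ k ≤ n, prefixValue (fun m => if m < n then w m else z (m - n)) k
      = prefixValue w k := by
    intro k
    induction k with
    | zero => intro _; rfl
    | succ k ih =>
      intro hk
      simp only [prefixValue]
      rw [ih (by omega), if_pos (by omega)]
  have := two_pow_mul_ofDigits (fun m => if m < n then w m else z (m - n)) n
  rw [hpre n le_rfl] at this
  simp only [Nat.add_sub_cancel, show ∀ i, ¬ (i + n < n) by intro i; omega, if_false, hz] at this
  have hp : (0 : ℝ) < 2 ^ n := by positivity
  nlinarith

/-! ### Random digits and mass distribution -/

/-- The law of a sequence of independent uniform binary digit vectors. -/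
noncomputable def digitMeasure (d : ℕ) : Measure (ℕ → Fin d → Fin 2) :=
  Measure.infinitePi fun _ : ℕ => uniformOn (univ : Set (Fin d → Fin 2))

instance (d : ℕ) : IsProbabilityMeasure (digitMeasure d) := by
  unfold digitMeasure; infer_instance

lemma digitMeasure_cylinder {d : ℕ} (J : Finset ℕ) (w : ℕ → Fin d → Fin 2) :
    digitMeasure d {y | ∀ m ∈ J, y m = w m} = ((2 ^ d : ℝ≥0∞)⁻¹) ^ J.card := by
  have : {y : ℕ → Fin d → Fin 2 | ∀ m ∈ J, y m = w m} = Set.pi (J : Set ℕ) fun m => {w m} := by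
    ext y; simp [Set.mem_pi]
  rw [this, digitMeasure, Measure.infinitePi_pi]
  · simp [uniformOn_univ, div_eq_mul_inv]
  · intro i _
    exact measurableSet_singleton _

open Classical in
/-- The number of elements of `S` below `n`. -/
noncomputable def countBelow (S : Set ℕ) (n : ℕ) : ℕ := ((Finset.range n).filter (· ∈ S)).card

/-- A small set meets at most `5 ^ d` classes of `n`-digit prefixes. Since `f` keeps the digits on
`S`, each class pulls back into a cylinder fixing the input at the levels of `S` below `n`. Passing
to the closure gives measurability without changing the diameter. -/
lemma codeMeasure_le {d : ℕ} {S : Set ℕ} {f : (ℕ → Fin d → Fin 2) → ℕ → Fin d → Fin 2}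
    (hf : Measurable f) (hfS : ∀ x, ∀ m ∈ S, f x m = x m) (n : ℕ) (s : Set (Torus d))
    (hs : Metric.ediam s ≤ ENNReal.ofReal ((2 ^ n)⁻¹)) :
    (digitMeasure d).map (code ∘ f) s
      ≤ ENNReal.ofReal (5 ^ d * 2 ^ (-((d * countBelow S n : ℕ) : ℝ))) := by
  classical
  have hmeas : Measurable (code ∘ f) := continuous_code.measurable.comp hf
  refine (measure_mono subset_closure).trans ?_
  rw [← Metric.ediam_closure] at hs
  rw [Measure.map_apply hmeas isClosed_closure.measurableSet]
  obtain ⟨W, hW, hcov⟩ := exists_cover_near n (closure s) fun x hx y hy => by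
    have := (Metric.edist_le_ediam_of_mem hx hy).trans hs
    rwa [edist_dist, ENNReal.ofReal_le_ofReal_iff (by positivity)] at this
  set J := (Finset.range n).filter (· ∈ S) with hJ
  calc digitMeasure d (code ∘ f ⁻¹' closure s)
      ≤ digitMeasure d (⋃ w ∈ W, {y | ∀ m ∈ J, y m = w m}) := by
        refine measure_mono fun y hy => ?_
        obtain ⟨w, hw, hyw⟩ := hcov (f y) hy
        simp only [mem_iUnion]
        refine ⟨w, hw, fun m hm => ?_⟩
        rw [hJ, Finset.mem_filter, Finset.mem_range] at hm
        rw [← hfS y m hm.2, hyw m hm.1]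
    _ ≤ ∑ w ∈ W, digitMeasure d {y | ∀ m ∈ J, y m = w m} := measure_biUnion_finset_le _ _
    _ = W.card * ((2 ^ d : ℝ≥0∞)⁻¹) ^ J.card := by
        simp [digitMeasure_cylinder]
    _ ≤ 5 ^ d * ((2 ^ d : ℝ≥0∞)⁻¹) ^ J.card := by
        gcongr
        exact_mod_cast hW
    _ = _ := by
        rw [ENNReal.ofReal_mul (by positivity), Real.rpow_neg (by positivity), Real.rpow_natCast,
          ENNReal.ofReal_inv_of_pos (by positivity), ENNReal.ofReal_pow (by positivity),
          ENNReal.ofReal_pow (by positivity)]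
        simp only [ENNReal.ofReal_ofNat, countBelow]
        simp only [pow_mul, ENNReal.inv_pow, ← hJ]

/-- A form of the mass distribution principle along dyadic diameters. -/
lemma le_dimH_of_measure_le {X : Type*} [MetricSpace X] [MeasurableSpace X] [BorelSpace X]
    (μ : Measure X) {A : Set X} (hA : μ A ≠ 0) {C σ : ℝ} (hC : 0 < C) (hσ : 0 < σ)
    (h : ∀ (n : ℕ) (s : Set X), Metric.ediam s ≤ ENNReal.ofReal ((2 ^ n)⁻¹) →
      μ s ≤ ENNReal.ofReal (C * 2 ^ (-(σ * n)))) :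
    ENNReal.ofReal σ ≤ dimH A := by
  -- The factor `2 ^ σ` pays for rounding a diameter up to a power of `1 / 2`.
  set K : ℝ≥0∞ := ENNReal.ofReal (C * 2 ^ σ) with hK
  have hKpos : 0 < C * (2:ℝ) ^ σ := by positivity
  have hK0 : K ≠ 0 := by simpa [hK] using hKpos
  have hKt : K ≠ ⊤ := ENNReal.ofReal_ne_top
  have key : K⁻¹ • μ ≤ μH[σ] := by
    refine Measure.le_hausdorffMeasure σ _ 1 one_pos fun s hs => ?_
    rw [Measure.smul_apply, smul_eq_mul, ENNReal.inv_mul_le_iff hK0 hKt]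
    rcases eq_or_ne (Metric.ediam s) 0 with h0 | h0
    · have : μ s ≤ 0 := by
        refine ge_of_tendsto' (f := fun n : ℕ => ENNReal.ofReal (C * 2 ^ (-(σ * n)))) (x := atTop)
          ?_ fun n => h n s (by rw [h0]; exact zero_le)
        rw [← ENNReal.ofReal_zero]
        refine ENNReal.tendsto_ofReal ?_
        have h2 : Tendsto (fun n : ℕ => ((2:ℝ) ^ (-σ)) ^ n) atTop (𝓝 0) :=
          tendsto_pow_atTop_nhds_zero_of_lt_one (by positivity)
            (Real.rpow_lt_one_of_one_lt_of_neg one_lt_two (by linarith))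
        have h3 := h2.const_mul C
        rw [mul_zero] at h3
        refine h3.congr fun n => ?_
        rw [← Real.rpow_natCast, ← Real.rpow_mul (by norm_num), neg_mul]
      exact this.trans (zero_le)
    · have hst : Metric.ediam s ≠ ⊤ := ne_top_of_le_ne_top ENNReal.one_ne_top hs
      obtain ⟨δ, hδ0, hδ⟩ : ∃ δ : ℝ, 0 < δ ∧ Metric.ediam s = ENNReal.ofReal δ :=
        ⟨_, ENNReal.toReal_pos h0 hst, (ENNReal.ofReal_toReal hst).symm⟩
      rw [hδ] at hs ⊢
      have hδ1 : δ ≤ 1 := by simpa using hs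
      obtain ⟨n, hn1, hn2⟩ := exists_nat_pow_near_of_lt_one hδ0 hδ1 (y := (1/2 : ℝ))
        (by norm_num) (by norm_num)
      refine (h n s (by rw [hδ]; exact ENNReal.ofReal_le_ofReal (by simpa using hn2))).trans ?_
      rw [ENNReal.ofReal_rpow_of_pos hδ0, hK, ← ENNReal.ofReal_mul hKpos.le]
      refine ENNReal.ofReal_le_ofReal ?_
      rw [mul_assoc]
      gcongr
      have e : (2:ℝ) ^ (-(σ * n)) = 2 ^ σ * (((1/2 : ℝ) ^ (n+1)) ^ σ) := by
        rw [one_div, inv_pow, ← Real.rpow_natCast, ← Real.rpow_neg (by norm_num),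
          ← Real.rpow_mul (by norm_num), ← Real.rpow_add (by norm_num)]
        push_cast
        congr 1
        ring
      rw [e]
      gcongr
  have hne : μH[σ] A ≠ 0 := by
    intro h0
    have := key A
    rw [h0, Measure.smul_apply, smul_eq_mul] at this
    have h1 := le_antisymm this (zero_le)
    rcases mul_eq_zero.mp h1 with h1 | h1
    · exact hKt (by simpa using h1)
    · exact hA h1
  have := le_dimH_of_hausdorffMeasure_ne_zero (d := σ.toNNReal)
    (by rwa [Real.coe_toNNReal _ hσ.le])
  exact this

/-- A cover by small balls must carry the whole mass of `A`, so it has many members. The upper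
dimension is a limsup, hence infinitely many good scales suffice. -/
lemma le_upperBoxDim {X : Type*} [MetricSpace X] [MeasurableSpace X]
    (μ : Measure X) [IsFiniteMeasure μ] {A : Set X} (hA : μ A ≠ 0) {C σ : ℝ} (hC : 0 < C)
    (h : ∃ᶠ n : ℕ in atTop, ∀ s : Set X, Metric.ediam s ≤ ENNReal.ofReal ((2 ^ n)⁻¹) →
      μ s ≤ ENNReal.ofReal (C * 2 ^ (-(σ * n)))) :
    ENNReal.ofReal σ ≤ upperBoxDim A := by
  set m : ℝ := (μ A).toReal with hm
  have hm0 : 0 < m := ENNReal.toReal_pos hA (measure_ne_top _ _)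
  have hcov : ∀ n : ℕ, (∀ s : Set X, Metric.ediam s ≤ ENNReal.ofReal ((2 ^ n)⁻¹) →
      μ s ≤ ENNReal.ofReal (C * 2 ^ (-(σ * n)))) → ∀ r : ℝ≥0, (r : ℝ) = (2 ^ (n + 1))⁻¹ →
      -- Radius `2 ^ (-(n + 1))` makes the diameter of each ball at most `2 ^ (-n)`.
      ENNReal.ofReal (m / C * 2 ^ (σ * n)) ≤ (Metric.coveringNumber r A : ℝ≥0∞) := by
    intro n hn r hr
    by_cases htop : Metric.coveringNumber r A = ⊤
    · simp [htop]
    have hfin := Metric.finite_minimalCover (ε := r) (A := A)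
    have hc := Metric.isCover_minimalCover htop
    rw [← Metric.encard_minimalCover htop, hfin.encard_eq_coe_toFinset_card]
    rw [Metric.isCover_iff_subset_iUnion_closedBall] at hc
    have h1 : μ A ≤ hfin.toFinset.card * ENNReal.ofReal (C * 2 ^ (-(σ * n))) := by
      calc μ A ≤ μ (⋃ y ∈ hfin.toFinset, Metric.closedBall y r) :=
            measure_mono (by simpa using hc)
        _ ≤ ∑ y ∈ hfin.toFinset, μ (Metric.closedBall y r) := measure_biUnion_finset_le _ _
        _ ≤ ∑ y ∈ hfin.toFinset, ENNReal.ofReal (C * 2 ^ (-(σ * n))) := by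
            refine Finset.sum_le_sum fun y _ => hn _ ?_
            refine Metric.ediam_le fun a ha b hb => ?_
            rw [edist_dist]
            refine ENNReal.ofReal_le_ofReal ?_
            have := dist_triangle_right a b y
            rw [Metric.mem_closedBall] at ha hb
            have e : ((2:ℝ) ^ n)⁻¹ = r + r := by rw [hr, pow_succ]; field_simp; norm_num
            linarith
        _ = _ := by simp
    have h2 : m ≤ hfin.toFinset.card * (C * 2 ^ (-(σ * n))) := by
      have := ENNReal.toReal_mono (by finiteness) h1
      rw [ENNReal.toReal_mul, ENNReal.toReal_ofReal (by positivity)] at this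
      simpa using this
    rw [show (((hfin.toFinset.card : ℕ∞) : ℝ≥0∞)) = ENNReal.ofReal (hfin.toFinset.card : ℝ) by simp]
    refine ENNReal.ofReal_le_ofReal ?_
    rw [Real.rpow_neg (by norm_num)] at h2
    rw [div_mul_eq_mul_div, div_le_iff₀ hC]
    have hp : (0:ℝ) < 2 ^ (σ * n) := by positivity
    calc m * 2 ^ (σ * n) ≤ (hfin.toFinset.card * (C * (2 ^ (σ * n))⁻¹)) * 2 ^ (σ * n) := by gcongr
      _ = _ := by field_simp
  refine le_of_forall_lt_imp_le_of_dense fun c hc => ?_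
  have hct : c ≠ ⊤ := hc.ne_top
  have hcσ : c.toReal < σ := (ENNReal.lt_ofReal_iff_toReal_lt hct).mp hc
  have hlog2 : 0 < Real.log 2 := Real.log_pos one_lt_two
  have hlim : Tendsto (fun n : ℕ => (Real.log (m / C) + σ * n * Real.log 2)
      / ((n + 1) * Real.log 2)) atTop (𝓝 σ) := by
    have h1 : Tendsto (fun n : ℕ => (Real.log (m / C) / Real.log 2 - σ) * (1 / ((n : ℝ) + 1)) + σ)
        atTop (𝓝 ((Real.log (m / C) / Real.log 2 - σ) * 0 + σ)) :=
      (tendsto_one_div_add_atTop_nhds_zero_nat.const_mul _).add_const σ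
    rw [mul_zero, zero_add] at h1
    refine h1.congr fun n => ?_
    have : (n : ℝ) + 1 ≠ 0 := by positivity
    field_simp
    ring
  have hev := hlim.eventually (lt_mem_nhds hcσ)
  have hfreq := h.and_eventually hev
  let r : ℕ → ℝ≥0 := fun n => (2 ^ (n + 1))⁻¹
  have hr : Tendsto r atTop (𝓝[>] 0) := by
    refine tendsto_nhdsWithin_iff.mpr ⟨?_, Eventually.of_forall fun n => by simp [r]⟩
    have := (NNReal.tendsto_pow_atTop_nhds_zero_of_lt_one (r := (2⁻¹ : ℝ≥0))
      (by rw [← NNReal.coe_lt_coe]; norm_num)).comp (tendsto_add_atTop_nat 1)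
    refine this.congr fun n => ?_
    simp [r]
  unfold upperBoxDim
  refine le_limsup_of_frequently_le' (hr.frequently (hfreq.mono fun n ⟨hn, hn'⟩ => ?_))
  have hcn := hcov n hn (r n) (by simp [r])
  have hpos : 0 < m / C * 2 ^ (σ * n) := by positivity
  have hl := ENNReal.log_le_log hcn
  rw [ENNReal.log_ofReal_of_pos hpos, Real.log_mul (by positivity) (by positivity),
    Real.log_rpow (by norm_num)] at hl
  have hlr : -Real.log (r n : ℝ) = (n + 1) * Real.log 2 := by
    simp [r, Real.log_inv, Real.log_pow]
  rw [hlr]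
  have hq := EReal.toENNReal_le_toENNReal (EReal.div_le_div_right_of_nonneg
    (c := (((n + 1) * Real.log 2 : ℝ) : EReal)) (by exact_mod_cast (by positivity)) hl)
  refine le_trans ?_ hq
  rw [← EReal.coe_div, EReal.real_coe_toENNReal, ← ENNReal.ofReal_toReal hct]
  exact ENNReal.ofReal_le_ofReal hn'.le

/-! ### Dyadic cells and the Borel–Cantelli argument -/

/-- The points of the torus having a binary expansion which agrees with `w` below `c`. -/
def dyadicCell {d : ℕ} (c : ℕ) (w : ℕ → Fin d → Fin 2) : Set (Torus d) :=
  code '' {y | ∀ m < c, y m = w m}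

lemma isClosed_dyadicCell {d : ℕ} (c : ℕ) (w : ℕ → Fin d → Fin 2) : IsClosed (dyadicCell c w) := by
  refine (IsCompact.image ?_ continuous_code).isClosed
  refine IsClosed.isCompact ?_
  simp only [ofPred_forall]
  exact isClosed_iInter fun m => isClosed_iInter fun _ =>
    isClosed_eq (continuous_apply m) continuous_const

/-- The ball is the closed dyadic interval with prefix `w`, described by its midpoint so that the
known measure of balls on the circle applies. -/
lemma exists_code_eq_of_mem_closedBall {w : ℕ → Fin 2} {c : ℕ} {u : UnitAddCircle}
    (hu : u ∈ Metric.closedBall ((((prefixValue w c + 1 / 2) / 2 ^ c : ℝ)) : UnitAddCircle)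
      ((2 ^ c)⁻¹ / 2)) :
    ∃ y : ℕ → Fin 2, (∀ m < c, y m = w m) ∧ ((Real.ofDigits y : ℝ) : UnitAddCircle) = u := by
  obtain ⟨p, rfl⟩ := QuotientAddGroup.mk_surjective u
  change ((p : ℝ) : UnitAddCircle) ∈ _ at hu
  set m : ℝ := (prefixValue w c + 1 / 2) / 2 ^ c with hm
  rw [Metric.mem_closedBall, dist_eq_norm, ← AddCircle.coe_sub, UnitAddCircle.norm_eq, abs_le] at hu
  set r := round (p - m)
  have hp : (0 : ℝ) < 2 ^ c := by positivity
  have hm' : 2 ^ c * m = prefixValue w c + 1 / 2 := by rw [hm]; field_simp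
  have hi : (2:ℝ) ^ c * ((2 ^ c)⁻¹ / 2) = 1 / 2 := by field_simp
  obtain ⟨y, hy, hyp⟩ := exists_code_eq_of_near (w := w) (n := c) (p := p - r)
    (by nlinarith [mul_le_mul_of_nonneg_left hu.1 hp.le])
    (by nlinarith [mul_le_mul_of_nonneg_left hu.2 hp.le])
  refine ⟨y, hy, ?_⟩
  rw [hyp, AddCircle.coe_sub]
  have : ((r : ℝ) : UnitAddCircle) = 0 := by
    rw [AddCircle.coe_eq_zero_iff]
    exact ⟨r, by simp⟩
  rw [this, sub_zero]

lemma torusUniform_dyadicCell {d : ℕ} (c : ℕ) (w : ℕ → Fin d → Fin 2) :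
    ENNReal.ofReal ((2 ^ (d * c))⁻¹) ≤ torusUniform d (dyadicCell c w) := by
  rw [torusUniform, Measure.map_apply (PiLp.continuous_toLp 2 _).measurable
    (isClosed_dyadicCell c w).measurableSet]
  calc ENNReal.ofReal ((2 ^ (d * c))⁻¹)
      = volume (Set.pi univ fun i : Fin d => Metric.closedBall
          ((((prefixValue (fun m => w m i) c + 1 / 2) / 2 ^ c : ℝ)) : UnitAddCircle)
          ((2 ^ c)⁻¹ / 2)) := by
        rw [volume_pi_pi]
        simp only [AddCircle.volume_closedBall]
        rw [mul_div_cancel₀ _ two_ne_zero, min_eq_right (inv_le_one_of_one_le₀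
          (one_le_pow₀ one_le_two)), Finset.prod_const, Finset.card_univ, Fintype.card_fin,
          ← ENNReal.ofReal_pow (by positivity), inv_pow, ← pow_mul, mul_comm c]
    _ ≤ _ := by
        refine measure_mono fun u hu => ?_
        have := fun i => exists_code_eq_of_mem_closedBall (hu i (mem_univ i))
        choose y hy hyu using this
        refine ⟨fun m i => y i m, fun m hm => funext fun i => hy i m hm, ?_⟩
        simp only [code]
        congr 1
        exact funext hyu

/-- A given cell is missed by at least `2 ^ (d * c k) * M k` independent points with probability at
most `exp (-M k)`. Summing over `2 ^ (d * c k) ≤ exp (d * c k)` cells leaves at most `exp (-k)`,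
which is summable. -/
lemma ae_eventually_forall_exists_mem_dyadicCell {d : ℕ} {Ω : Type u} [MeasurableSpace Ω]
    {P : Measure Ω} [IsProbabilityMeasure P] {ξ : ℕ → Ω → Torus d} (hξ : IsIndepUniform ξ P)
    {c N M : ℕ → ℕ} (hN : ∀ k, N k + 2 ^ (d * c k) * M k ≤ N (k + 1))
    (hM : ∀ k, d * c k + k ≤ M k) :
    ∀ᵐ ω ∂P, ∀ᶠ k in atTop, ∀ w, ∃ n, N k ≤ n ∧ n < N (k + 1) ∧ ξ n ω ∈ dyadicCell (c k) w := by
  -- Cells depend only on finite words; padding these by zeros turns the union over `w` into a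
  -- finite one.
  let ext : ∀ k, (Fin (c k) → Fin d → Fin 2) → ℕ → Fin d → Fin 2 := fun k v m =>
    if h : m < c k then v ⟨m, h⟩ else 0
  have : IsProbabilityMeasure (torusUniform d) := by
    rw [← hξ.map_eq 0]
    exact Measure.isProbabilityMeasure_map (hξ.measurable 0).aemeasurable
  let B : ℕ → Set Ω := fun k => ⋃ v, ⋂ n ∈ Finset.Ico (N k) (N (k + 1)),
    ξ n ⁻¹' (dyadicCell (c k) (ext k v))ᶜ
  have hcell : ∀ k v, torusUniform d (dyadicCell (c k) (ext k v))ᶜ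
      ≤ ENNReal.ofReal (Real.exp (-(2 ^ (d * c k))⁻¹)) := by
    intro k v
    rw [prob_compl_eq_one_sub (isClosed_dyadicCell _ _).measurableSet]
    calc 1 - torusUniform d (dyadicCell (c k) (ext k v))
        ≤ ENNReal.ofReal 1 - ENNReal.ofReal ((2 ^ (d * c k))⁻¹) := by
          rw [ENNReal.ofReal_one]
          exact tsub_le_tsub_left (torusUniform_dyadicCell _ _) _
      _ = ENNReal.ofReal (1 - (2 ^ (d * c k))⁻¹) := (ENNReal.ofReal_sub _ (by positivity)).symm
      _ ≤ _ := ENNReal.ofReal_le_ofReal (Real.one_sub_le_exp_neg _)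
  have hB : ∀ k, P (B k) ≤ ENNReal.ofReal (Real.exp (-1) ^ k) := by
    intro k
    have hone : ∀ v, P (⋂ n ∈ Finset.Ico (N k) (N (k + 1)),
        ξ n ⁻¹' (dyadicCell (c k) (ext k v))ᶜ) ≤ ENNReal.ofReal (Real.exp (-(M k))) := by
      intro v
      have hms := (isClosed_dyadicCell (c k) (ext k v)).measurableSet.compl
      rw [hξ.indep.measure_inter_preimage_eq_mul (Finset.Ico (N k) (N (k + 1))) (fun _ _ => hms)]
      calc ∏ n ∈ Finset.Ico (N k) (N (k + 1)), P (ξ n ⁻¹' (dyadicCell (c k) (ext k v))ᶜ)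
          ≤ ∏ n ∈ Finset.Ico (N k) (N (k + 1)),
              ENNReal.ofReal (Real.exp (-(2 ^ (d * c k))⁻¹)) := by
            refine Finset.prod_le_prod' fun n _ => ?_
            rw [← Measure.map_apply (hξ.measurable n) hms, hξ.map_eq n]
            exact hcell k v
        _ = ENNReal.ofReal (Real.exp (((N (k + 1) - N k : ℕ) : ℝ) * (-(2 ^ (d * c k))⁻¹))) := by
            rw [Finset.prod_const, Nat.card_Ico, ← ENNReal.ofReal_pow (Real.exp_nonneg _),
              ← Real.exp_nat_mul]
        _ ≤ _ := by
            refine ENNReal.ofReal_le_ofReal (Real.exp_le_exp.mpr ?_)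
            rw [mul_neg, neg_le_neg_iff, ← div_eq_mul_inv, le_div_iff₀ (by positivity)]
            have := hN k
            have h2 : 2 ^ (d * c k) * M k ≤ N (k + 1) - N k := by omega
            rw [mul_comm]
            exact_mod_cast h2
    calc P (B k) ≤ ∑ v, P (⋂ n ∈ Finset.Ico (N k) (N (k + 1)),
            ξ n ⁻¹' (dyadicCell (c k) (ext k v))ᶜ) := measure_iUnion_fintype_le _ _
      _ ≤ ∑ _v : Fin (c k) → Fin d → Fin 2, ENNReal.ofReal (Real.exp (-(M k))) :=
          Finset.sum_le_sum fun v _ => hone v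
      _ = ENNReal.ofReal (2 ^ (d * c k) * Real.exp (-(M k))) := by
          rw [ENNReal.ofReal_mul (by positivity), ENNReal.ofReal_pow (by positivity), pow_mul]
          simp
      _ ≤ _ := by
          refine ENNReal.ofReal_le_ofReal ?_
          rw [← Real.exp_nat_mul]
          calc (2:ℝ) ^ (d * c k) * Real.exp (-(M k))
              ≤ Real.exp 1 ^ (d * c k) * Real.exp (-(M k)) := by
                gcongr
                linarith [Real.add_one_le_exp 1]
            _ = Real.exp (((d * c k : ℕ) : ℝ) * 1 + -(M k)) := by
                rw [← Real.exp_nat_mul, ← Real.exp_add]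
            _ ≤ _ := by
                refine Real.exp_le_exp.mpr ?_
                have : ((d * c k + k : ℕ) : ℝ) ≤ M k := by exact_mod_cast hM k
                push_cast at this ⊢
                linarith
  have hsum : ∑' k, P (B k) ≠ ⊤ := by
    refine ne_top_of_le_ne_top ?_ (ENNReal.tsum_le_tsum hB)
    refine Summable.tsum_ofReal_ne_top ?_
    exact summable_geometric_of_lt_one (Real.exp_nonneg _) (Real.exp_neg_one_lt_half.trans (by norm_num))
  filter_upwards [ae_eventually_notMem hsum] with ω hω
  filter_upwards [hω] with k hk w
  simp only [B, mem_iUnion, mem_iInter, not_exists, not_forall, mem_preimage, mem_compl_iff,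
    not_not, Finset.mem_Ico] at hk
  obtain ⟨n, hn, hmem⟩ := hk fun m => w m
  refine ⟨n, hn.1, hn.2, ?_⟩
  convert hmem using 1
  unfold dyadicCell
  congr 1
  ext y
  refine forall₂_congr fun m hm => ?_
  simp [ext, hm]

/-! ### Counting free levels -/

lemma countBelow_zero (S : Set ℕ) : countBelow S 0 = 0 := by simp [countBelow]

lemma countBelow_succ_of_mem {S : Set ℕ} {n : ℕ} (h : n ∈ S) :
    countBelow S (n + 1) = countBelow S n + 1 := by
  simp [countBelow, Finset.range_add_one, Finset.filter_insert, h]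

lemma countBelow_succ_of_notMem {S : Set ℕ} {n : ℕ} (h : n ∉ S) :
    countBelow S (n + 1) = countBelow S n := by
  simp [countBelow, Finset.range_add_one, Finset.filter_insert, h]

lemma countBelow_univ (n : ℕ) : countBelow univ n = n := by simp [countBelow]

lemma countBelow_le (S : Set ℕ) (n : ℕ) : countBelow S n ≤ n := by
  classical
  simpa [countBelow] using Finset.card_filter_le (Finset.range n) (· ∈ S)

/-- On `[m, n)` the count of `T` grows no faster than that of `S`; the sums avoid truncated
subtraction. -/
lemma countBelow_add_le {S T : Set ℕ} {m n : ℕ} (hmn : m ≤ n)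
    (h : ∀ j, m ≤ j → j < n → j ∈ T → j ∈ S) :
    countBelow S m + countBelow T n ≤ countBelow S n + countBelow T m := by
  induction n, hmn using Nat.le_induction with
  | base => rfl
  | succ n hmn ih =>
    have ih := ih fun j h1 h2 => h j h1 (by omega)
    by_cases hT : n ∈ T
    · rw [countBelow_succ_of_mem hT, countBelow_succ_of_mem (h n hmn (by omega) hT)]
      omega
    · rw [countBelow_succ_of_notMem hT]
      by_cases hS : n ∈ S
      · rw [countBelow_succ_of_mem hS]; omega
      · rw [countBelow_succ_of_notMem hS]; omega

/-- A set of natural numbers of density `θ`, for `0 ≤ θ ≤ 1`. -/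
def beattySet (θ : ℝ) : Set ℕ := {m | ⌊(m : ℝ) * θ⌋₊ < ⌊((m : ℝ) + 1) * θ⌋₊}

lemma countBelow_beattySet {θ : ℝ} (h0 : 0 ≤ θ) (h1 : θ ≤ 1) (n : ℕ) :
    countBelow (beattySet θ) n = ⌊(n : ℝ) * θ⌋₊ := by
  induction n with
  | zero => simp [countBelow_zero]
  | succ n ih =>
    have hle : ⌊((n : ℝ) + 1) * θ⌋₊ ≤ ⌊(n : ℝ) * θ⌋₊ + 1 := by
      rw [← Nat.floor_add_one (by positivity)]
      exact Nat.floor_le_floor (by linarith)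
    have hge : ⌊(n : ℝ) * θ⌋₊ ≤ ⌊((n : ℝ) + 1) * θ⌋₊ := Nat.floor_le_floor (by linarith)
    push_cast
    by_cases h : n ∈ beattySet θ
    · rw [countBelow_succ_of_mem h, ih]
      simp only [beattySet, mem_ofPred_eq] at h
      omega
    · rw [countBelow_succ_of_notMem h, ih]
      simp only [beattySet, mem_ofPred_eq] at h
      omega

/-- Two interlaced rapidly increasing sequences of levels. -/
structure Interlaced (a b : ℕ → ℕ) : Prop where
  pos : ∀ k, 1 ≤ a k
  low : ∀ k, (k + 2) * a k ≤ b k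
  high : ∀ k, (k + 2) * b k ≤ a (k + 1)

namespace Interlaced

variable {a b : ℕ → ℕ}

lemma two_mul_low (h : Interlaced a b) (k : ℕ) : 2 * a k ≤ b k :=
  (Nat.mul_le_mul_right _ (by omega)).trans (h.low k)

lemma two_mul_high (h : Interlaced a b) (k : ℕ) : 2 * b k ≤ a (k + 1) :=
  (Nat.mul_le_mul_right _ (by omega)).trans (h.high k)

lemma high_mono (h : Interlaced a b) : Monotone b :=
  monotone_nat_of_le_succ fun k => by
    have := h.two_mul_low (k + 1); have := h.two_mul_high k; omega

lemma low_mono (h : Interlaced a b) : Monotone a :=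
  monotone_nat_of_le_succ fun k => by
    have := h.two_mul_low k; have := h.two_mul_high k; omega

lemma high_le_low (h : Interlaced a b) {j k : ℕ} (hjk : j < k) : b j ≤ a k := by
  have h1 := h.two_mul_high j
  have h2 := h.low_mono (show j + 1 ≤ k from hjk)
  omega

lemma lt_low (h : Interlaced a b) (k : ℕ) : k < a k := by
  induction k with
  | zero => exact h.pos 0
  | succ k ih => have := h.two_mul_low k; have := h.two_mul_high k; omega

lemma lt_high (h : Interlaced a b) (k : ℕ) : k < b k := by
  have := h.lt_low k; have := h.two_mul_low k; omega

lemma eventually_low_le (h : Interlaced a b) {ε : ℝ} (hε : 0 < ε) :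
    ∀ᶠ k in atTop, (a k : ℝ) ≤ ε * b k := by
  filter_upwards [eventually_ge_atTop ⌈1 / ε⌉₊] with k hk
  have h1 : 1 / ε ≤ k := (Nat.le_ceil _).trans (by exact_mod_cast hk)
  rw [div_le_iff₀ hε] at h1
  have h2 : ((k + 2 : ℕ) : ℝ) * a k ≤ b k := by exact_mod_cast h.low k
  push_cast at h2
  have h3 : (0 : ℝ) ≤ a k := by positivity
  nlinarith [mul_le_mul_of_nonneg_left h2 hε.le, mul_nonneg hε.le h3,
    mul_le_mul_of_nonneg_right h1 h3]

lemma eventually_high_le (h : Interlaced a b) {ε : ℝ} (hε : 0 < ε) :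
    ∀ᶠ k in atTop, (b k : ℝ) ≤ ε * a (k + 1) := by
  filter_upwards [eventually_ge_atTop ⌈1 / ε⌉₊] with k hk
  have h1 : 1 / ε ≤ k := (Nat.le_ceil _).trans (by exact_mod_cast hk)
  rw [div_le_iff₀ hε] at h1
  have h2 : ((k + 2 : ℕ) : ℝ) * b k ≤ a (k + 1) := by exact_mod_cast h.high k
  push_cast at h2
  have h3 : (0 : ℝ) ≤ b k := by positivity
  nlinarith [mul_le_mul_of_nonneg_left h2 hε.le, mul_nonneg hε.le h3,
    mul_le_mul_of_nonneg_right h1 h3]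

end Interlaced

/-- The free levels of the deterministic fractal. -/
def freeLevels (θ : ℝ) (a b : ℕ → ℕ) : Set ℕ :=
  beattySet θ ∪ {m | ∃ k, a k ≤ m ∧ m < b k}

/-- The levels which remain free if, from the scale number `k₀` on, the digits in `[c k, b k)` are
prescribed. -/
def remainingLevels (θ : ℝ) (a b c : ℕ → ℕ) (k₀ : ℕ) : Set ℕ :=
  {m ∈ freeLevels θ a b | ∀ k ≥ k₀, ¬ (c k ≤ m ∧ m < b k)}

section Levels

variable {θ : ℝ} {a b c : ℕ → ℕ}

lemma le_countBelow_freeLevels (h0 : 0 ≤ θ) (h1 : θ ≤ 1) (n : ℕ) :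
    n * θ - 1 ≤ countBelow (freeLevels θ a b) n := by
  have := countBelow_add_le (S := freeLevels θ a b) (T := beattySet θ) (Nat.zero_le n)
    fun j _ _ hj => Or.inl hj
  rw [countBelow_zero, countBelow_zero, countBelow_beattySet h0 h1, zero_add, add_zero] at this
  have h2 := Nat.lt_floor_add_one ((n : ℝ) * θ)
  have h3 : ((⌊(n : ℝ) * θ⌋₊ : ℕ) : ℝ) ≤ countBelow (freeLevels θ a b) n := by exact_mod_cast this
  linarith

/-- Since `a k` is negligible against `b k`, almost all levels below `b k` are free: this is the
source of full packing dimension. -/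
lemma le_countBelow_freeLevels_high (h : Interlaced a b) (k : ℕ) :
    b k ≤ countBelow (freeLevels θ a b) (b k) + a k := by
  have := countBelow_add_le (S := freeLevels θ a b) (T := univ)
    (m := a k) (n := b k) (by have := h.two_mul_low k; omega)
    fun j h1 h2 _ => Or.inr ⟨k, h1, h2⟩
  simp only [countBelow_univ] at this
  omega

/-- No window meets `[b k, a (k + 1))`, so only the sparse levels contribute there, and `b k` is
negligible: this is the source of the small Hausdorff dimension. -/
lemma countBelow_freeLevels_low_le (h : Interlaced a b) (h0 : 0 ≤ θ) (h1 : θ ≤ 1) (k : ℕ) :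
    (countBelow (freeLevels θ a b) (a (k + 1)) : ℝ) ≤ b k + a (k + 1) * θ := by
  have := countBelow_add_le (S := beattySet θ) (T := freeLevels θ a b)
    (m := b k) (n := a (k + 1)) (h.high_le_low (by omega)) fun j h1 h2 hj => by
      rcases hj with hj | ⟨i, hi1, hi2⟩
      · exact hj
      · rcases Nat.lt_or_ge k i with hi | hi
        · have := h.low_mono (show k + 1 ≤ i from hi); omega
        · have := h.high_mono hi; omega
  rw [countBelow_beattySet h0 h1, countBelow_beattySet h0 h1] at this
  have h2 := countBelow_le (freeLevels θ a b) (b k)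
  have h3 : countBelow (freeLevels θ a b) (a (k + 1)) ≤ b k + ⌊(a (k + 1) : ℝ) * θ⌋₊ := by omega
  have h4 : ((⌊(a (k + 1) : ℝ) * θ⌋₊ : ℕ) : ℝ) ≤ a (k + 1) * θ := Nat.floor_le (by positivity)
  have h5 : (countBelow (freeLevels θ a b) (a (k + 1)) : ℝ) ≤ b k + ⌊(a (k + 1) : ℝ) * θ⌋₊ := by
    exact_mod_cast h3
  linarith

/-- The free proportion is critical at the end of a prescribed gap `[c k, b k)`, where the levels in
`[a k, c k)` already give nearly `γ * b k`. Beyond it the count grows at rate `θ` up to `a (k + 1)`,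
then at rate `1` up to `c (k + 1)`. The additive loss comes from the initial segment below `b k₀`
and from integer parts. -/
lemma le_countBelow_remainingLevels (h : Interlaced a b) (h0 : 0 ≤ θ) (h1 : θ ≤ 1)
    {γ ρ ε : ℝ} (hγ1 : γ ≤ 1) (hρ : 0 ≤ ρ) (hε : 0 ≤ ε) (hργ : ρ + ε ≤ γ) (hρθ : ρ + ε ≤ θ)
    (hc : ∀ k, c k = ⌊γ * b k⌋₊) {k₀ : ℕ} (hk₀ : ∀ k ≥ k₀, (a k : ℝ) ≤ ε * b k) (n : ℕ) :
    ρ * n - (b k₀ + 2) ≤ countBelow (remainingLevels θ a b c k₀) n := by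
  set R := remainingLevels θ a b c k₀
  have hγ0 : 0 ≤ γ := by linarith
  have hac : ∀ k ≥ k₀, a k ≤ c k := fun k hk => by
    rw [hc]
    refine Nat.le_floor ((hk₀ k hk).trans ?_)
    gcongr; linarith
  have hcb : ∀ k, c k ≤ b k := fun k => by
    rw [hc]
    refine Nat.floor_le_of_le ?_
    have : (0:ℝ) ≤ b k := by positivity
    nlinarith
  have hcγ : ∀ k, γ * b k - 1 ≤ c k := fun k => by
    rw [hc]
    have := Nat.lt_floor_add_one (γ * b k)
    linarith
  have hfull : ∀ k ≥ k₀, ∀ m, a k ≤ m → m < c k → m ∈ R := by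
    intro k hk m hm1 hm2
    refine ⟨Or.inr ⟨k, hm1, hm2.trans_le (hcb k)⟩, fun j hj hjm => ?_⟩
    rcases lt_trichotomy j k with hjk | rfl | hjk
    · have := h.high_le_low hjk; omega
    · omega
    · have := h.high_le_low hjk; have := hac j hj; have := hcb k; omega
  have hsparse : ∀ k, ∀ m, b k ≤ m → m < a (k + 1) → m ∈ beattySet θ → m ∈ R := by
    intro k m hm1 hm2 hm
    refine ⟨Or.inl hm, fun j hj hjm => ?_⟩
    rcases Nat.lt_or_ge k j with hjk | hjk
    · have := h.low_mono (show k + 1 ≤ j from hjk); have := hac j hj; omega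
    · have := h.high_mono hjk; omega
  have hcount : ∀ k ≥ k₀, ∀ m, a k ≤ m → m ≤ c k →
      countBelow R (a k) + m ≤ countBelow R m + a k := by
    intro k hk m hm1 hm2
    have := countBelow_add_le (S := R) (T := univ) hm1
      fun j h1 h2 _ => hfull k hk j h1 (by omega)
    simpa only [countBelow_univ] using this
  have hmono : ∀ m n, m ≤ n → countBelow R m ≤ countBelow R n := by
    intro m n hmn
    have := countBelow_add_le (S := R) (T := ∅) hmn (by simp)
    simpa [countBelow] using this
  -- The levels in `[a k, c k)` alone give `c k - a k ≥ (γ - ε) * b k - 1`, and this bound persists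
  -- across the gap.
  have hend : ∀ k ≥ k₀, ∀ m, c k ≤ m → (ρ * b k - 1 : ℝ) ≤ countBelow R m := by
    intro k hk m hm
    have e1 := hcount k hk (c k) (hac k hk) le_rfl
    have e2 := hmono _ _ hm
    have e3 : (c k : ℝ) ≤ countBelow R m + a k := by exact_mod_cast (by omega)
    have e4 := hcγ k
    have e5 := hk₀ k hk
    have e6 : (0:ℝ) ≤ b k := by positivity
    nlinarith
  have hmid : ∀ k ≥ k₀, ∀ m, b k ≤ m → m ≤ a (k + 1) → (ρ * m - 2 : ℝ) ≤ countBelow R m := by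
    intro k hk m hm1 hm2
    have e1 := hend k hk (b k) (hcb k)
    have e2 := countBelow_add_le (S := R) (T := beattySet θ) hm1
      fun j h1 h2 h3 => hsparse k j h1 (by omega) h3
    rw [countBelow_beattySet h0 h1, countBelow_beattySet h0 h1] at e2
    have e3 := Nat.lt_floor_add_one ((m : ℝ) * θ)
    have e4 : ((⌊(b k : ℝ) * θ⌋₊ : ℕ) : ℝ) ≤ b k * θ := Nat.floor_le (by positivity)
    have e5 : (countBelow R (b k) : ℝ) + ⌊(m : ℝ) * θ⌋₊ ≤ countBelow R m + ⌊(b k : ℝ) * θ⌋₊ := by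
      exact_mod_cast e2
    have e6 : (b k : ℝ) ≤ m := by exact_mod_cast hm1
    nlinarith
  have hbk₀ : (0:ℝ) ≤ b k₀ := by positivity
  have key : ∀ k ≥ k₀, ∀ n ≤ b k, ρ * n - (b k₀ + 2) ≤ countBelow R n := by
    intro k hk
    induction k, hk using Nat.le_induction with
    | base =>
      intro n hn
      have e1 : (n : ℝ) ≤ b k₀ := by exact_mod_cast hn
      have e2 : (0 : ℝ) ≤ countBelow R n := by positivity
      have e3 : (0:ℝ) ≤ n := by positivity
      nlinarith
    | succ k hk ih =>
      intro n hn
      rcases le_total n (b k) with h2 | h2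
      · exact ih n h2
      rcases le_total n (a (k + 1)) with h3 | h3
      · linarith [hmid k hk n h2 h3]
      rcases le_total n (c (k + 1)) with h4 | h4
      · have e1 := hmid k hk (a (k + 1)) (h.high_le_low (by omega)) le_rfl
        have e2 := hcount (k + 1) (by omega) n h3 h4
        have e3 : (countBelow R (a (k + 1)) : ℝ) + n ≤ countBelow R n + a (k + 1) := by
          exact_mod_cast e2
        have e4 : (a (k + 1) : ℝ) ≤ n := by exact_mod_cast h3
        nlinarith
      · have e1 := hend (k + 1) (by omega) n h4
        have e2 : (n : ℝ) ≤ b (k + 1) := by exact_mod_cast hn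
        nlinarith
  refine key (max k₀ n) (le_max_left _ _) n ?_
  have := h.lt_high (max k₀ n)
  omega

end Levels

/-! ### Steering digit sequences -/

open Classical in
/-- The sequence which agrees with `x` on `R`, and whose other digits are given by `g` in terms of
the preceding ones. -/
noncomputable def steer {D : Type*} (R : Set ℕ) (g : ∀ m : ℕ, (Fin m → D) → D) (x : ℕ → D)
    (m : ℕ) : D :=
  if m ∈ R then x m else g m fun i => steer R g x i
termination_by m
decreasing_by exact i.2

/-- Each rule `g m` has a finite domain, hence is measurable whatever choices it encodes. -/
lemma measurable_steer {D : Type*} [MeasurableSpace D] [Finite D] [MeasurableSingletonClass D]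
    (R : Set ℕ) (g : ∀ m : ℕ, (Fin m → D) → D) : Measurable (steer R g) := by
  refine measurable_pi_lambda _ fun m => ?_
  induction m using Nat.strong_induction_on with
  | _ m ih =>
    by_cases hm : m ∈ R
    · have : (fun x => steer R g x m) = fun x => x m := by
        funext x; rw [steer, if_pos hm]
      rw [this]
      exact measurable_pi_apply m
    · have : (fun x => steer R g x m) = fun x => g m fun i : Fin m => steer R g x i := by
        funext x; rw [steer, if_neg hm]
      rw [this]
      exact (measurable_of_countable (g m)).comp (measurable_pi_lambda _ fun i => ih i i.2)

/-- The gaps `[c k, b k)` are disjoint, so each level obeys at most one target `z k`, and the target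
depends on the output only through its first `c k` digits. The recursion is therefore well defined,
and no measurability of `z` in `w` is required. -/
lemma exists_measurable_steering {D : Type*} [MeasurableSpace D] [Finite D] [Zero D]
    [MeasurableSingletonClass D] {R : Set ℕ} {c b : ℕ → ℕ} {k₀ : ℕ}
    (hdisj : ∀ j ≥ k₀, ∀ k ≥ k₀, j < k → b j ≤ c k)
    (hR : ∀ k ≥ k₀, ∀ m ∈ R, ¬ (c k ≤ m ∧ m < b k))
    {z : ℕ → (ℕ → D) → ℕ → D} (hz : ∀ k ≥ k₀, ∀ w, ∀ m < c k, z k w m = w m) :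
    ∃ f : (ℕ → D) → ℕ → D, Measurable f ∧ (∀ x, ∀ m ∈ R, f x m = x m) ∧
      (∀ x, ∀ m ∉ R, (∀ k ≥ k₀, ¬ (c k ≤ m ∧ m < b k)) → f x m = 0) ∧
      ∀ x, ∀ k ≥ k₀, ∃ w, ∀ m < b k, f x m = z k w m := by
  classical
  let Q : ℕ → ℕ → Prop := fun m k => k₀ ≤ k ∧ c k ≤ m ∧ m < b k
  have huniq : ∀ m j k, Q m j → Q m k → j = k := by
    rintro m j k ⟨h1, h2, h3⟩ ⟨h4, h5, h6⟩
    rcases lt_trichotomy j k with h | h | h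
    · have := hdisj j h1 k h4 h; omega
    · exact h
    · have := hdisj k h4 j h1 h; omega
  -- Truncating at `c k` feeds `z k` the same word at every level of the gap, so all copied digits
  -- come from one target.
  let trunc : ℕ → (ℕ → D) → ℕ → D := fun n w m => if m < n then w m else 0
  let g : ∀ m : ℕ, (Fin m → D) → D := fun m v =>
    if h : ∃ k, Q m k then
      z h.choose (trunc (c h.choose) fun i => if hi : i < m then v ⟨i, hi⟩ else 0) m
    else 0
  refine ⟨steer R g, measurable_steer R g, fun x m hm => by rw [steer, if_pos hm],
    fun x m hm hk => ?_, fun x k hk => ⟨trunc (c k) (steer R g x), fun m hm => ?_⟩⟩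
  · rw [steer, if_neg hm]
    have : ¬ ∃ k, Q m k := fun ⟨k, h1, h2⟩ => hk k h1 h2
    simp only [g, dif_neg this]
  · rcases Nat.lt_or_ge m (c k) with hmc | hmc
    · rw [hz k hk _ m hmc]
      simp [trunc, hmc]
    · have hQ : Q m k := ⟨hk, hmc, hm⟩
      have hex : ∃ k, Q m k := ⟨k, hQ⟩
      have hch : hex.choose = k := huniq m _ _ hex.choose_spec hQ
      rw [steer, if_neg fun hmR => hR k hk m hmR ⟨hmc, hm⟩]
      simp only [g, dif_pos hex, hch]
      congr 1
      funext i
      by_cases hi : i < c k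
      · simp [trunc, hi, hi.trans_le hmc]
      · simp [trunc, hi]

/-! ### Lower bounds for Hausdorff and packing dimension -/

section LowerBounds

variable {d : ℕ} {R : Set ℕ} {f : (ℕ → Fin d → Fin 2) → ℕ → Fin d → Fin 2} {A : Set (Torus d)}

lemma codeMeasure_le_of_le_countBelow (hf : Measurable f) (hfR : ∀ x, ∀ m ∈ R, f x m = x m)
    {ρ B : ℝ} {n : ℕ} (hn : ρ * n - B ≤ countBelow R n) {s : Set (Torus d)}
    (hs : Metric.ediam s ≤ ENNReal.ofReal ((2 ^ n)⁻¹)) :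
    (digitMeasure d).map (code ∘ f) s
      ≤ ENNReal.ofReal (5 ^ d * 2 ^ (d * B) * 2 ^ (-(d * ρ * n))) := by
  refine (codeMeasure_le hf hfR n s hs).trans (ENNReal.ofReal_le_ofReal ?_)
  rw [mul_assoc, ← Real.rpow_add two_pos]
  gcongr
  · norm_num
  · have hd : (0:ℝ) ≤ d := by positivity
    push_cast
    nlinarith

lemma codeMeasure_ne_zero (hf : Measurable f) (hA : range (code ∘ f) ⊆ A) :
    (digitMeasure d).map (code ∘ f) A ≠ 0 := by
  have h1 := Measure.le_map_apply (μ := digitMeasure d)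
    (continuous_code.measurable.comp hf).aemeasurable A
  rw [preimage_eq_univ_iff.mpr hA, measure_univ] at h1
  exact (lt_of_lt_of_le one_pos h1).ne'

lemma le_dimH_of_range_subset (hd : 1 ≤ d) (hf : Measurable f)
    (hfR : ∀ x, ∀ m ∈ R, f x m = x m) {ρ B : ℝ} (hρ : 0 < ρ)
    (h : ∀ n : ℕ, ρ * n - B ≤ countBelow R n) (hA : range (code ∘ f) ⊆ A) :
    ENNReal.ofReal (d * ρ) ≤ dimH A := by
  have : (0:ℝ) < d := by exact_mod_cast hd
  exact le_dimH_of_measure_le _ (codeMeasure_ne_zero hf hA) (C := 5 ^ d * 2 ^ (d * B))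
    (by positivity) (by positivity) fun n s hs => codeMeasure_le_of_le_countBelow hf hfR (h n) hs

/-- In a countable cover of `A` some piece has positive measure, and the box-counting bound applies
to that piece. -/
lemma le_dimP_of_range_subset (hf : Measurable f)
    (hfR : ∀ x, ∀ m ∈ R, f x m = x m)
    (h : ∀ ρ < (1 : ℝ), ∃ᶠ n : ℕ in atTop, ρ * n ≤ countBelow R n) (hA : range (code ∘ f) ⊆ A) :
    (d : ℝ≥0∞) ≤ dimP A := by
  have : IsProbabilityMeasure ((digitMeasure d).map (code ∘ f)) :=
    Measure.isProbabilityMeasure_map (continuous_code.measurable.comp hf).aemeasurable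
  refine le_iInf₂ fun U hU => ?_
  obtain ⟨i, hi⟩ : ∃ i, (digitMeasure d).map (code ∘ f) (U i) ≠ 0 := by
    by_contra! h0
    exact codeMeasure_ne_zero hf hA (measure_mono_null hU (measure_iUnion_null h0))
  refine le_trans ?_ (le_iSup _ i)
  have key : ∀ ρ < (1:ℝ), ENNReal.ofReal (d * ρ) ≤ upperBoxDim (U i) := fun ρ hρ =>
    le_upperBoxDim _ hi (C := 5 ^ d * 2 ^ (d * (0:ℝ))) (by positivity)
      ((h ρ hρ).mono fun n hn s hs =>
        codeMeasure_le_of_le_countBelow hf hfR (by simpa using hn) hs)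
  have hlim : Tendsto (fun ρ : ℝ => ENNReal.ofReal (d * ρ)) (𝓝[<] 1) (𝓝 (d : ℝ≥0∞)) := by
    have : Tendsto (fun ρ : ℝ => ENNReal.ofReal (d * ρ)) (𝓝 1) (𝓝 (ENNReal.ofReal (d * 1))) :=
      ENNReal.tendsto_ofReal (tendsto_id.const_mul _)
    rw [mul_one, ENNReal.ofReal_natCast] at this
    exact this.mono_left nhdsWithin_le_nhds
  exact le_of_tendsto hlim (eventually_mem_nhdsWithin.mono fun ρ hρ => key ρ hρ)

end LowerBounds

/-! ### Upper bounds for the dimensions -/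

lemma code_surjective {d : ℕ} : Function.Surjective (code (d := d)) := by
  intro x
  have : ∀ i, ∃ y : ℕ → Fin 2, ((Real.ofDigits y : ℝ) : UnitAddCircle) = x i := fun i => by
    -- At level `0` the ball has radius `1 / 2` and is the whole circle.
    obtain ⟨y, -, hy⟩ := exists_code_eq_of_mem_closedBall (w := 0) (c := 0) (u := x i) (by
      rw [Metric.mem_closedBall, dist_eq_norm]
      refine (AddCircle.norm_le_half_period (1:ℝ) one_ne_zero).trans ?_
      norm_num)
    exact ⟨y, hy⟩
  choose y hy using this
  refine ⟨fun m i => y i m, ?_⟩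
  simp only [code]
  simp [hy]

lemma coveringNumber_univ_torus_le {d n : ℕ} {r : ℝ≥0} (hr : d * (2 ^ n : ℝ)⁻¹ ≤ r) :
    (Metric.coveringNumber r (univ : Set (Torus d)) : ℝ≥0∞) ≤ 2 ^ (d * n) := by
  classical
  let g : (Fin n → Fin d → Fin 2) → Torus d := fun v =>
    code fun m => if h : m < n then v ⟨m, h⟩ else 0
  have hc : Metric.IsCover r (univ : Set (Torus d)) ((Finset.univ.image g : Finset _) : Set _) := by
    rw [Metric.isCover_iff_subset_iUnion_closedBall]
    intro x _
    obtain ⟨y, rfl⟩ := code_surjective x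
    simp only [mem_iUnion, Finset.coe_image, Finset.coe_univ, image_univ, mem_range,
      exists_prop, exists_exists_eq_and, Metric.mem_closedBall]
    exact ⟨fun m => y m, (dist_code_le fun m hm => by simp [hm]).trans hr⟩
  have h1 := hc.coveringNumber_le_encard (subset_univ _)
  rw [Set.encard_coe_eq_coe_finsetCard] at h1
  have h2 : (Finset.univ.image g).card ≤ 2 ^ (d * n) := by
    refine Finset.card_image_le.trans ?_
    simp [pow_mul]
  calc (Metric.coveringNumber r (univ : Set (Torus d)) : ℝ≥0∞)
      ≤ (((Finset.univ.image g).card : ℕ∞) : ℝ≥0∞) := by gcongr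
    _ ≤ _ := by exact_mod_cast h2

lemma upperBoxDim_univ_torus_le {d : ℕ} (hd : 1 ≤ d) :
    upperBoxDim (univ : Set (Torus d)) ≤ d := by
  have hd' : (1:ℝ) ≤ d := by exact_mod_cast hd
  have hbound : ∀ᶠ r : ℝ≥0 in 𝓝[>] 0,
      (ENNReal.log (Metric.coveringNumber r (univ : Set (Torus d)) : ℝ≥0∞) /
        ((-Real.log (r : ℝ) : ℝ) : EReal)).toENNReal
      ≤ ENNReal.ofReal (d * (Real.log d + Real.log 2) / (-Real.log r) + d) := by
    have h1 : ∀ᶠ r : ℝ≥0 in 𝓝[>] 0, r < 1 := nhdsWithin_le_nhds (gt_mem_nhds one_pos)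
    filter_upwards [h1, self_mem_nhdsWithin] with r hr1 hr0
    have hr0' : (0:ℝ) < r := hr0
    have hr1' : (r:ℝ) < 1 := hr1
    have hL : 0 < -Real.log r := by linarith [Real.log_neg hr0' hr1']
    obtain ⟨n, hn1, hn2⟩ := exists_nat_pow_near (x := (d / r : ℝ)) (y := 2)
      (by rw [le_div_iff₀ hr0']; linarith) one_lt_two
    have hcov := coveringNumber_univ_torus_le (d := d) (n := n + 1) (r := r) (by
      rw [← div_eq_mul_inv, div_le_iff₀ (by positivity), mul_comm]
      exact ((div_lt_iff₀ hr0').mp hn2).le)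
    have hl := ENNReal.log_le_log hcov
    rw [show (2:ℝ≥0∞) ^ (d * (n + 1)) = ENNReal.ofReal (2 ^ (d * (n + 1))) by
      rw [ENNReal.ofReal_pow (by positivity)]; simp, ENNReal.log_ofReal_of_pos (by positivity)] at hl
    have hq := EReal.toENNReal_le_toENNReal (EReal.div_le_div_right_of_nonneg
      (c := ((-Real.log r : ℝ) : EReal)) (by exact_mod_cast hL.le) hl)
    refine hq.trans ?_
    rw [← EReal.coe_div, EReal.real_coe_toENNReal]
    refine ENNReal.ofReal_le_ofReal ?_
    have hlog : Real.log (2 ^ n) ≤ Real.log (d / r) := Real.log_le_log (by positivity) hn1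
    rw [Real.log_pow, Real.log_div (by positivity) (by positivity)] at hlog
    rw [Real.log_pow, div_add' _ _ _ hL.ne']
    gcongr
    push_cast
    nlinarith
  have hlim : Tendsto (fun r : ℝ≥0 =>
      ENNReal.ofReal (d * (Real.log d + Real.log 2) / (-Real.log r) + d)) (𝓝[>] 0)
      (𝓝 (d : ℝ≥0∞)) := by
    have h0 : Tendsto (fun r : ℝ≥0 => (r : ℝ)) (𝓝[>] 0) (𝓝[>] 0) := by
      refine tendsto_nhdsWithin_iff.mpr ⟨?_, ?_⟩
      · exact (NNReal.continuous_coe.tendsto' 0 0 rfl).mono_left nhdsWithin_le_nhds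
      · filter_upwards [self_mem_nhdsWithin] with r hr using hr
    have h1 := (tendsto_neg_atBot_atTop.comp (Real.tendsto_log_nhdsGT_zero.comp h0))
    have h2 := (h1.const_div_atTop (d * (Real.log d + Real.log 2))).add_const (d : ℝ)
    rw [zero_add] at h2
    have h3 := ENNReal.tendsto_ofReal h2
    rwa [ENNReal.ofReal_natCast] at h3
  have : (𝓝[>] (0 : ℝ≥0)).NeBot := inferInstance
  calc upperBoxDim (univ : Set (Torus d)) ≤ _ := limsup_le_limsup hbound
    _ = d := hlim.limsup_eq

lemma dimP_le {d : ℕ} (hd : 1 ≤ d) (A : Set (Torus d)) : dimP A ≤ d :=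
  (iInf₂_le (fun _ : ℕ => (univ : Set (Torus d))) (by simp [iUnion_const])).trans
    (by simpa using upperBoxDim_univ_torus_le hd)

lemma dimH_le_of_hausdorffMeasure_eq_zero {X : Type*} [MetricSpace X] [MeasurableSpace X]
    [BorelSpace X] {A : Set X} {σ : ℝ} (hσ : 0 ≤ σ) (h : ∀ s : ℝ, σ < s → μH[s] A = 0) :
    dimH A ≤ ENNReal.ofReal σ := by
  by_contra! hlt
  obtain ⟨s, hs1, hs2⟩ := ENNReal.lt_iff_exists_nnreal_btwn.mp hlt
  have hs : σ < s := by
    have := (ENNReal.ofReal_lt_iff_lt_toReal hσ ENNReal.coe_ne_top).mp hs1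
    simpa using this
  exact absurd (dimH_le_of_hausdorffMeasure_ne_top (d := s) (by rw [h s hs]; simp)) hs2.not_ge

/-- The Cantor set of points whose binary digits vanish outside of the free levels. -/
def cantorTorus (d : ℕ) (θ : ℝ) (a b : ℕ → ℕ) : Set (Torus d) :=
  code '' {y | ∀ m ∉ freeLevels θ a b, y m = 0}

lemma isClosed_cantorTorus (d : ℕ) (θ : ℝ) (a b : ℕ → ℕ) : IsClosed (cantorTorus d θ a b) := by
  refine (IsCompact.image ?_ continuous_code).isClosed
  refine IsClosed.isCompact ?_
  simp only [ofPred_forall]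
  exact isClosed_iInter fun m => isClosed_iInter fun _ =>
    isClosed_eq (continuous_apply m) continuous_const

/-- The set is covered by its cylinders of level `a (k + 1)`, of which there are about `2 ^ (d * θ *
a (k + 1))` up to a subexponential factor. -/
lemma dimH_cantorTorus_le (d : ℕ) {θ : ℝ} {a b : ℕ → ℕ} (h : Interlaced a b) (h0 : 0 ≤ θ)
    (h1 : θ ≤ 1) : dimH (cantorTorus d θ a b) ≤ ENNReal.ofReal (d * θ) := by
  classical
  refine dimH_le_of_hausdorffMeasure_eq_zero (by positivity) fun s hs => ?_
  have hs0 : 0 < s := lt_of_le_of_lt (by positivity) hs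
  set δ := s - d * θ with hδ
  have hδ0 : 0 < δ := by linarith
  let S := freeLevels θ a b
  let J : ℕ → Finset ℕ := fun k => (Finset.range (a (k + 1))).filter (· ∈ S)
  let t : ∀ k, (J k → Fin d → Fin 2) → Set (Torus d) := fun k v =>
    code '' {y | (∀ m ∉ S, y m = 0) ∧ ∀ m (hm : m ∈ J k), y m = v ⟨m, hm⟩}
  have ha : Tendsto (fun k => a (k + 1)) atTop atTop :=
    tendsto_atTop_mono (fun k => (Nat.le_succ k).trans (h.lt_low (k + 1)).le) tendsto_id
  have hdiam : ∀ k v, Metric.ediam (t k v) ≤ ENNReal.ofReal (d * (2 ^ a (k + 1))⁻¹) := by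
    intro k v
    refine Metric.ediam_le ?_
    rintro _ ⟨y, hy, rfl⟩ _ ⟨y', hy', rfl⟩
    rw [edist_dist]
    refine ENNReal.ofReal_le_ofReal (dist_code_le fun m hm => ?_)
    by_cases hmS : m ∈ S
    · have hmJ : m ∈ J k := by simp [J, hm, hmS]
      rw [hy.2 m hmJ, hy'.2 m hmJ]
    · rw [hy.1 m hmS, hy'.1 m hmS]
  have hcover : ∀ k, cantorTorus d θ a b ⊆ ⋃ v, t k v := by
    rintro k _ ⟨y, hy, rfl⟩
    exact mem_iUnion.mpr ⟨fun m => y m, y, ⟨hy, fun _ _ => rfl⟩, rfl⟩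
  have hsum : ∀ᶠ k in atTop, ∑ v, Metric.ediam (t k v) ^ s
      ≤ ENNReal.ofReal (d ^ s * (2 ^ (-(δ / 2))) ^ a (k + 1)) := by
    -- This `ε` makes `d * b k` cost at most half of the excess `δ` in the exponent; `d + 1` keeps
    -- the denominator nonzero when `d = 0`.
    filter_upwards [h.eventually_high_le (ε := δ / (2 * (d + 1))) (by positivity)] with k hk
    have hcnt := countBelow_freeLevels_low_le h h0 h1 k
    have hdb : d * (b k : ℝ) ≤ δ / 2 * a (k + 1) := by
      have hak : (0:ℝ) ≤ a (k + 1) := by positivity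
      have e1 : (d + 1) * (b k : ℝ) ≤ (d + 1) * (δ / (2 * (d + 1)) * a (k + 1)) := by gcongr
      have e2 : ((d:ℝ) + 1) * (δ / (2 * (d + 1)) * a (k + 1)) = δ / 2 * a (k + 1) := by
        field_simp
      have e3 : (0:ℝ) ≤ b k := by positivity
      linarith
    calc ∑ v, Metric.ediam (t k v) ^ s
        ≤ ∑ _v : J k → Fin d → Fin 2, ENNReal.ofReal (d * (2 ^ a (k + 1))⁻¹) ^ s :=
          Finset.sum_le_sum fun v _ => by gcongr; exact hdiam k v
      _ = ENNReal.ofReal (2 ^ (d * countBelow S (a (k + 1))) * (d * (2 ^ a (k + 1))⁻¹) ^ s) := by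
          rw [ENNReal.ofReal_mul (p := 2 ^ (d * countBelow S (a (k + 1)))) (by positivity),
            ENNReal.ofReal_pow (by positivity), pow_mul,
            ← ENNReal.ofReal_rpow_of_nonneg (by positivity) hs0.le]
          simp [J, countBelow]
      _ ≤ _ := by
          refine ENNReal.ofReal_le_ofReal ?_
          rw [Real.mul_rpow (by positivity) (by positivity), mul_left_comm]
          gcongr
          rw [← Real.rpow_natCast 2 (a (k + 1)), ← Real.rpow_neg (by norm_num),
            ← Real.rpow_mul (by norm_num), ← Real.rpow_natCast 2, ← Real.rpow_add (by norm_num),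
            ← Real.rpow_natCast, ← Real.rpow_mul (by norm_num)]
          refine Real.rpow_le_rpow_of_exponent_le one_le_two ?_
          push_cast
          have hd0 : (0:ℝ) ≤ d := by positivity
          nlinarith [mul_le_mul_of_nonneg_left hcnt hd0]
  have hzero : Tendsto (fun k => ENNReal.ofReal (d ^ s * (2 ^ (-(δ / 2))) ^ a (k + 1))) atTop
      (𝓝 0) := by
    rw [← ENNReal.ofReal_zero]
    refine ENNReal.tendsto_ofReal ?_
    have := ((tendsto_pow_atTop_nhds_zero_of_lt_one (r := (2:ℝ) ^ (-(δ / 2))) (by positivity)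
      (Real.rpow_lt_one_of_one_lt_of_neg one_lt_two (by linarith))).comp ha).const_mul
      ((d:ℝ) ^ s)
    rwa [mul_zero] at this
  have hr : Tendsto (fun k => ENNReal.ofReal (d * (2 ^ a (k + 1))⁻¹)) atTop (𝓝 0) := by
    rw [← ENNReal.ofReal_zero]
    refine ENNReal.tendsto_ofReal ?_
    have := ((tendsto_pow_atTop_nhds_zero_of_lt_one (r := (2:ℝ)⁻¹) (by positivity)
      (by norm_num)).comp ha).const_mul (d:ℝ)
    rw [mul_zero] at this
    refine this.congr fun k => ?_
    simp
  refine le_antisymm ?_ zero_le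
  calc μH[s] (cantorTorus d θ a b) ≤ liminf (fun k => ∑ v, Metric.ediam (t k v) ^ s) atTop :=
        Measure.hausdorffMeasure_le_liminf_sum s _ _ hr t (Eventually.of_forall hdiam)
          (Eventually.of_forall hcover)
    _ ≤ liminf (fun k => ENNReal.ofReal (d ^ s * (2 ^ (-(δ / 2))) ^ a (k + 1))) atTop :=
        liminf_le_liminf hsum
    _ = 0 := hzero.liminf_eq

/-- The bound holds for every outcome: for `s' > α`, eventually `l n ≤ n ^ (-1 / s')`, so `∑ l n ^
s` converges for `s > s'`, and each tail of balls covers the limsup set. -/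
lemma dimH_coveringSet_le {d : ℕ} {Ω : Type u} {l : ℕ → ℝ} (hl : IsDiameterSeq l) {α : ℝ}
    (hα : 0 ≤ α) (hlα : coveringExponent l ≤ α) (ξ : ℕ → Ω → Torus d) (ω : Ω) :
    dimH (coveringSet l ξ ω) ≤ ENNReal.ofReal α := by
  refine dimH_le_of_hausdorffMeasure_eq_zero hα fun s hs => ?_
  obtain ⟨s', hs'1, hs'2⟩ := exists_between hs
  have hs' : 0 < s' := by linarith
  have hs0 : 0 < s := by linarith
  have hev : ∀ᶠ n : ℕ in atTop, l n ≤ (n : ℝ) ^ (-(1 / s')) := by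
    have h1 := eventually_lt_of_limsup_lt (lt_of_le_of_lt hlα (EReal.coe_lt_coe_iff.mpr hs'1))
    filter_upwards [h1, eventually_gt_atTop 0] with n hn hn0
    have hn' := EReal.coe_lt_coe_iff.mp hn
    have hlog : 0 < -Real.log (l n) := by
      linarith [Real.log_neg (hl.pos n) (lt_of_le_of_lt (hl.le_half n) (by norm_num))]
    rw [div_lt_iff₀ hlog] at hn'
    have hn0' : (0:ℝ) < n := by exact_mod_cast hn0
    rw [← Real.log_le_log_iff (hl.pos n) (by positivity), Real.log_rpow hn0']
    rw [neg_mul, le_neg, one_div, inv_mul_le_iff₀ hs']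
    exact hn'.le
  have hlim : Tendsto l atTop (𝓝 0) := by
    refine squeeze_zero' (Eventually.of_forall fun n => (hl.pos n).le) hev ?_
    exact (tendsto_rpow_neg_atTop (by positivity)).comp tendsto_natCast_atTop_atTop
  have hsum : Summable fun n => l n ^ s := by
    refine Summable.of_norm_bounded_eventually_nat (g := fun n : ℕ => (n : ℝ) ^ (-(1 / s') * s))
      (Real.summable_nat_rpow.mpr ?_) ?_
    · rw [neg_mul, neg_lt_neg_iff, one_div, inv_mul_eq_div, lt_div_iff₀ hs']
      linarith
    · filter_upwards [hev] with n hn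
      rw [Real.norm_of_nonneg (Real.rpow_nonneg (hl.pos n).le _), Real.rpow_mul (by positivity)]
      exact Real.rpow_le_rpow (hl.pos n).le hn hs0.le
  have hdiam : ∀ n : ℕ, Metric.ediam (Metric.closedBall (ξ n ω) (l n / 2))
      ≤ ENNReal.ofReal (l n) := by
    intro n
    refine Metric.ediam_le fun x hx y hy => ?_
    rw [edist_dist]
    refine ENNReal.ofReal_le_ofReal ?_
    rw [Metric.mem_closedBall] at hx hy
    linarith [dist_triangle_right x y (ξ n ω)]
  refine le_antisymm ?_ zero_le
  calc μH[s] (coveringSet l ξ ω)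
      ≤ liminf (fun N => ∑' i : ℕ,
          Metric.ediam (Metric.closedBall (ξ (i + N) ω) (l (i + N) / 2)) ^ s) atTop := by
        refine Measure.hausdorffMeasure_le_liminf_tsum (ι := fun _ => ℕ) s _
          (fun N => ENNReal.ofReal (l N)) ?_ _ (Eventually.of_forall fun N i => ?_)
          (Eventually.of_forall fun N x hx => ?_)
        · rw [← ENNReal.ofReal_zero]
          exact ENNReal.tendsto_ofReal hlim
        · exact (hdiam _).trans (ENNReal.ofReal_le_ofReal (hl.antitone (Nat.le_add_left _ _)))
        · obtain ⟨k, hk, hxk⟩ := mem_iUnion₂.mp (mem_iInter.mp hx N)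
          exact mem_iUnion.mpr ⟨k - N, by rwa [Nat.sub_add_cancel hk]⟩
    _ ≤ liminf (fun N => ∑' i : ℕ, ENNReal.ofReal (l (i + N) ^ s)) atTop := by
        refine liminf_le_liminf (Eventually.of_forall fun N => ENNReal.tsum_le_tsum fun i => ?_)
        rw [← ENNReal.ofReal_rpow_of_pos (hl.pos _)]
        gcongr
        exact hdiam _
    _ = 0 := (ENNReal.tendsto_sum_nat_add (fun n => ENNReal.ofReal (l n ^ s))
        hsum.tsum_ofReal_ne_top).liminf_eq

/-! ### Blocks of indices and the covering exponent -/

lemma exists_interlaced (c : ℕ) : ∃ a b : ℕ → ℕ, Interlaced a b ∧ ∀ k, c ≤ a k := by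
  -- Consecutive factorials, alternating between the two sequences, have ratios that grow without
  -- bound; the shift `c + 1` gives the lower bound by `c`.
  refine ⟨fun k => (2 * k + (c + 1)).factorial, fun k => (2 * k + 1 + (c + 1)).factorial,
    ⟨fun k => Nat.factorial_pos _, fun k => ?_, fun k => ?_⟩, fun k => ?_⟩
  · rw [show 2 * k + 1 + (c + 1) = (2 * k + (c + 1)) + 1 by ring, Nat.factorial_succ]
    exact Nat.mul_le_mul_right _ (by omega)
  · rw [show 2 * (k + 1) + (c + 1) = (2 * k + 1 + (c + 1)) + 1 by ring,
      Nat.factorial_succ (2 * k + 1 + (c + 1))]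
    exact Nat.mul_le_mul_right _ (by omega)
  · exact le_trans (by omega) (Nat.self_le_factorial _)

/-- The end points of the blocks of indices on which the diameters are constant. -/
noncomputable def blockEnd (d : ℕ) (γ : ℝ) (b : ℕ → ℕ) : ℕ → ℕ
  | 0 => 0
  | k + 1 => 2 ^ (d * ⌊γ * b k⌋₊) * (4 * d * b k)

section Blocks

variable {d : ℕ} {γ : ℝ} {a b : ℕ → ℕ}

/-- Half of the factor `4 * d * b k` absorbs all earlier blocks; the other half supplies the trials
for Borel–Cantelli. -/
lemma blockEnd_add_le (h : Interlaced a b) (hγ : 0 ≤ γ) (k : ℕ) :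
    blockEnd d γ b k + 2 ^ (d * ⌊γ * b k⌋₊) * (2 * d * b k) ≤ blockEnd d γ b (k + 1) := by
  have e : blockEnd d γ b (k + 1) = 2 ^ (d * ⌊γ * b k⌋₊) * (2 * d * b k)
      + 2 ^ (d * ⌊γ * b k⌋₊) * (2 * d * b k) := by
    simp only [blockEnd]; ring
  rw [e]
  gcongr
  cases k with
  | zero => exact Nat.zero_le _
  | succ k =>
    have h1 : 2 * b k ≤ b (k + 1) := by
      have := h.two_mul_high k; have := h.two_mul_low (k + 1); omega
    have h2 : ⌊γ * b k⌋₊ ≤ ⌊γ * b (k + 1)⌋₊ := by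
      refine Nat.floor_le_floor ?_
      gcongr
      omega
    simp only [blockEnd]
    refine Nat.mul_le_mul (Nat.pow_le_pow_right two_pos (Nat.mul_le_mul_left _ h2)) ?_
    calc 4 * d * b k = 2 * d * (2 * b k) := by ring
      _ ≤ _ := Nat.mul_le_mul_left _ h1

lemma strictMono_blockEnd (hd : 1 ≤ d) (h : Interlaced a b) (hγ : 0 ≤ γ) :
    StrictMono (blockEnd d γ b) := by
  refine strictMono_nat_of_lt_succ fun k => ?_
  have h1 := blockEnd_add_le (d := d) h hγ k
  have h2 : 0 < 2 ^ (d * ⌊γ * b k⌋₊) * (2 * d * b k) := by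
    have := h.lt_high k
    have : 0 < b k := by omega
    positivity
  omega

open Classical in
/-- The index of the block containing `n`. -/
noncomputable def blockIndex (d : ℕ) (γ : ℝ) (b : ℕ → ℕ) (n : ℕ) : ℕ :=
  -- The value `0` is a mere default: for `1 ≤ d`, interlaced levels and `0 ≤ γ` the block exists.
  if h : ∃ k, n < blockEnd d γ b (k + 1) then Nat.find h else 0

lemma exists_lt_blockEnd (hd : 1 ≤ d) (h : Interlaced a b) (hγ : 0 ≤ γ) (n : ℕ) :
    ∃ k, n < blockEnd d γ b (k + 1) :=
  ⟨n, (strictMono_blockEnd hd h hγ).le_apply (x := n + 1)⟩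

lemma lt_blockEnd_blockIndex (hd : 1 ≤ d) (h : Interlaced a b) (hγ : 0 ≤ γ) (n : ℕ) :
    n < blockEnd d γ b (blockIndex d γ b n + 1) := by
  classical
  have hex := exists_lt_blockEnd hd h hγ n
  rw [blockIndex, dif_pos hex]
  exact Nat.find_spec hex

lemma blockIndex_eq (hd : 1 ≤ d) (h : Interlaced a b) (hγ : 0 ≤ γ) {n k : ℕ}
    (h1 : blockEnd d γ b k ≤ n) (h2 : n < blockEnd d γ b (k + 1)) : blockIndex d γ b n = k := by
  classical
  rw [blockIndex, dif_pos ⟨k, h2⟩, Nat.find_eq_iff]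
  refine ⟨h2, fun j hj hlt => ?_⟩
  have := (strictMono_blockEnd hd h hγ).monotone (show j + 1 ≤ k from hj)
  omega

lemma blockIndex_mono (hd : 1 ≤ d) (h : Interlaced a b) (hγ : 0 ≤ γ) :
    Monotone (blockIndex d γ b) := by
  classical
  intro m n hmn
  have hex := exists_lt_blockEnd hd h hγ m
  conv_lhs => rw [blockIndex, dif_pos hex]
  exact Nat.find_min' hex (hmn.trans_lt (lt_blockEnd_blockIndex hd h hγ n))

/-- The diameters, constant on blocks. -/
noncomputable def blockDiameter (d : ℕ) (γ : ℝ) (b : ℕ → ℕ) (n : ℕ) : ℝ :=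
  -- Half of this is `2 ^ d * 2 ^ (-b k)`, which exceeds `d * 2 ^ (-b k)`, the bound for the
  -- distance of points sharing `b k` digits.
  2 ^ (d + 1) * (2 ^ b (blockIndex d γ b n))⁻¹

lemma isDiameterSeq_blockDiameter (hd : 1 ≤ d) (h : Interlaced a b) (hγ : 0 ≤ γ)
    (hb : ∀ k, d + 2 ≤ b k) : IsDiameterSeq (blockDiameter d γ b) where
  pos n := by unfold blockDiameter; positivity
  le_half n := by
    unfold blockDiameter
    rw [← div_eq_mul_inv, div_le_div_iff₀ (by positivity) two_pos, one_mul, ← pow_succ]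
    exact pow_le_pow_right₀ one_le_two (hb _)
  antitone m n hmn := by
    unfold blockDiameter
    gcongr
    · exact one_le_two
    · exact h.high_mono (blockIndex_mono hd h hγ hmn)

lemma tendsto_block_exponent (d : ℕ) (hγ : 0 ≤ γ) (C : ℝ) :
    Tendsto (fun x : ℝ => (d * ⌊γ * x⌋₊ * Real.log 2 + Real.log x + C)
      / ((x - (d + 1)) * Real.log 2)) atTop (𝓝 (d * γ)) := by
  have hlog : Real.log 2 ≠ 0 := (Real.log_pos one_lt_two).ne'
  have h1 := ((tendsto_nat_floor_mul_div_atTop hγ).const_mul (d : ℝ)).mul_const (Real.log 2)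
  have h2 : Tendsto (fun x : ℝ => Real.log x / x) atTop (𝓝 0) :=
    Real.isLittleO_log_id_atTop.tendsto_div_nhds_zero
  have h3 : Tendsto (fun x : ℝ => C / x) atTop (𝓝 0) := tendsto_id.const_div_atTop C
  have h4 : Tendsto (fun x : ℝ => ((d : ℝ) + 1) / x) atTop (𝓝 0) := tendsto_id.const_div_atTop _
  have h5 := ((h1.add h2).add h3).div ((h4.const_sub 1).mul_const (Real.log 2)) (by simpa using hlog)
  have e : ((d : ℝ) * γ * Real.log 2 + 0 + 0) / ((1 - 0) * Real.log 2) = d * γ := by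
    field_simp
    ring
  rw [e] at h5
  refine h5.congr' ?_
  filter_upwards [eventually_gt_atTop 0] with x hx
  simp only [Pi.div_apply]
  rw [← mul_div_mul_right _ _ hx.ne']
  congr 1
  · field_simp
  · field_simp

/-- Within a block the quotient is largest at the last index. Comparison with the block end gives
the upper bound; the last indices `φ k` attain it, with a loss of at most `log 2` in the numerator.
-/
lemma coveringExponent_blockDiameter (hd : 1 ≤ d) (h : Interlaced a b) (hγ : 0 ≤ γ)
    (hb : ∀ k, d + 2 ≤ b k) : coveringExponent (blockDiameter d γ b) = ((d * γ : ℝ) : EReal) := by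
  have hd' : (0:ℝ) < d := by exact_mod_cast hd
  have hbpos : ∀ k, (0:ℝ) < b k := fun k => by
    have := hb k
    exact_mod_cast (by omega : 0 < b k)
  have hbtop : Tendsto (fun k => (b k : ℝ)) atTop atTop :=
    tendsto_natCast_atTop_atTop.comp (tendsto_atTop_mono (fun k => (h.lt_high k).le) tendsto_id)
  have hlim : ∀ C : ℝ, Tendsto (fun k : ℕ => ((((d * ⌊γ * b k⌋₊ * Real.log 2 + Real.log (b k) + C)
      / ((b k - (d + 1)) * Real.log 2) : ℝ)) : EReal)) atTop (𝓝 ((d * γ : ℝ) : EReal)) := fun C =>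
    (continuous_coe_real_ereal.tendsto _).comp ((tendsto_block_exponent d hγ C).comp hbtop)
  have hnum : ∀ k, Real.log (blockEnd d γ b (k + 1)) =
      d * ⌊γ * b k⌋₊ * Real.log 2 + Real.log (b k) + Real.log (4 * d) := fun k => by
    have := hbpos k
    simp only [blockEnd]
    push_cast
    rw [Real.log_mul (by positivity) (by positivity), Real.log_mul (by positivity) (by positivity),
      Real.log_pow]
    push_cast
    ring
  have hden : ∀ n, -Real.log (blockDiameter d γ b n) =
      (b (blockIndex d γ b n) - (d + 1)) * Real.log 2 := fun n => by
    rw [blockDiameter, Real.log_mul (by positivity) (by positivity), Real.log_inv, Real.log_pow,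
      Real.log_pow]
    push_cast
    ring
  have hdenpos : ∀ k, 0 < ((b k : ℝ) - (d + 1)) * Real.log 2 := fun k => by
    refine mul_pos ?_ (Real.log_pos one_lt_two)
    have : ((d + 2 : ℕ) : ℝ) ≤ b k := by exact_mod_cast hb k
    push_cast at this
    linarith
  have hmono := strictMono_blockEnd hd h hγ
  refine le_antisymm ?_ ?_
  · have hidx : Tendsto (blockIndex d γ b) atTop atTop := by
      refine tendsto_atTop_atTop.mpr fun k => ⟨blockEnd d γ b k, fun n hn => ?_⟩
      by_contra! hlt
      have h1 := lt_blockEnd_blockIndex hd h hγ n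
      have h2 := hmono.monotone (show blockIndex d γ b n + 1 ≤ k from hlt)
      omega
    calc coveringExponent (blockDiameter d γ b)
        ≤ limsup (fun n => ((((d * ⌊γ * b (blockIndex d γ b n)⌋₊ * Real.log 2
            + Real.log (b (blockIndex d γ b n)) + Real.log (4 * d))
            / ((b (blockIndex d γ b n) - (d + 1)) * Real.log 2) : ℝ)) : EReal)) atTop := by
          refine limsup_le_limsup ?_
          filter_upwards [eventually_gt_atTop 0] with n hn
          rw [EReal.coe_le_coe_iff, hden, ← hnum]
          have := (hdenpos (blockIndex d γ b n)).le
          gcongr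
          exact (lt_blockEnd_blockIndex hd h hγ n).le
      _ = _ := ((hlim _).comp hidx).limsup_eq
  · let φ : ℕ → ℕ := fun k => blockEnd d γ b (k + 1) - 1
    have hφ : Tendsto φ atTop atTop := by
      refine tendsto_atTop_mono (fun k => ?_) tendsto_id
      have := hmono.le_apply (x := k + 1)
      simp only [φ, id]
      omega
    calc ((d * γ : ℝ) : EReal)
        = limsup (fun k => ((((d * ⌊γ * b k⌋₊ * Real.log 2
            + Real.log (b k) + (Real.log (4 * d) - Real.log 2))
            / ((b k - (d + 1)) * Real.log 2) : ℝ)) : EReal)) atTop := (hlim _).limsup_eq.symm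
      _ ≤ limsup (fun k => ((Real.log ((φ k : ℕ) : ℝ)
            / (-Real.log (blockDiameter d γ b (φ k))) : ℝ) : EReal)) atTop := by
          refine limsup_le_limsup (Eventually.of_forall fun k => ?_)
          simp only
          have h1 : blockEnd d γ b k < blockEnd d γ b (k + 1) := hmono (Nat.lt_succ_self k)
          have hφk : φ k = blockEnd d γ b (k + 1) - 1 := rfl
          have h2 : 2 ≤ blockEnd d γ b (k + 1) := by
            have e1 := hb k
            have e2 : 1 ≤ 2 ^ (d * ⌊γ * b k⌋₊) := Nat.one_le_two_pow
            simp only [blockEnd]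
            nlinarith [Nat.mul_le_mul hd e1, Nat.mul_le_mul e2 (Nat.mul_le_mul hd e1)]
          have h3 : blockIndex d γ b (φ k) = k := blockIndex_eq hd h hγ (by omega) (by omega)
          rw [EReal.coe_le_coe_iff, hden, h3]
          have := (hdenpos k).le
          gcongr
          have h4 : ((blockEnd d γ b (k + 1) : ℕ) : ℝ) ≤ 2 * (φ k : ℕ) := by
            exact_mod_cast (by omega : blockEnd d γ b (k + 1) ≤ 2 * φ k)
          have h5 : (0:ℝ) < (φ k : ℕ) := by exact_mod_cast (by omega : 0 < φ k)
          have h6 : (0:ℝ) < (blockEnd d γ b (k + 1) : ℕ) := by exact_mod_cast (by omega)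
          have h7 := Real.log_le_log h6 h4
          rw [hnum, Real.log_mul two_ne_zero h5.ne'] at h7
          linarith
      _ = limsup (fun n : ℕ => ((Real.log (n : ℝ)
            / (-Real.log (blockDiameter d γ b n)) : ℝ) : EReal)) (map φ atTop) :=
          limsup_comp (fun n : ℕ => ((Real.log (n : ℝ)
            / (-Real.log (blockDiameter d γ b n)) : ℝ) : EReal)) φ atTop
      _ ≤ coveringExponent (blockDiameter d γ b) := limsup_le_limsup_of_le hφ

end Blocks

/-! ### The intersection and the conclusion -/

lemma le_dimH_coveringSet_inter_cantorTorus {d : ℕ} (hd : 1 ≤ d) {Ω : Type u}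
    {ξ : ℕ → Ω → Torus d} {ω : Ω} {a b : ℕ → ℕ} (h : Interlaced a b) {γ θ ρ : ℝ}
    (hγ : γ ≤ 1) (hθ : θ ≤ 1) (hρ : 0 < ρ) (hργ : ρ < γ) (hρθ : ρ < θ)
    (hω : ∀ᶠ k in atTop, ∀ w, ∃ n, blockEnd d γ b k ≤ n ∧ n < blockEnd d γ b (k + 1) ∧
      ξ n ω ∈ dyadicCell ⌊γ * b k⌋₊ w) :
    ENNReal.ofReal (d * ρ)
      ≤ dimH (coveringSet (blockDiameter d γ b) ξ ω ∩ cantorTorus d θ a b) := by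
  have hγ0 : 0 ≤ γ := by linarith
  obtain ⟨ε, hε0, hεγ, hεθ⟩ : ∃ ε, 0 < ε ∧ ρ + ε ≤ γ ∧ ρ + ε ≤ θ :=
    ⟨min γ θ - ρ, by rw [sub_pos]; exact lt_min hργ hρθ,
      by linarith [min_le_left γ θ], by linarith [min_le_right γ θ]⟩
  obtain ⟨k₀, hk₀⟩ := eventually_atTop.mp (hω.and (h.eventually_low_le hε0))
  set c : ℕ → ℕ := fun k => ⌊γ * b k⌋₊ with hc
  -- The copied digits thus sit at free levels, so copying does not leave the Cantor set.
  have hac : ∀ k ≥ k₀, a k ≤ c k := fun k hk => by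
    refine Nat.le_floor (((hk₀ k hk).2).trans ?_)
    gcongr; linarith
  have hz : ∀ k, ∀ w : ℕ → Fin d → Fin 2, ∃ y : ℕ → Fin d → Fin 2, k₀ ≤ k →
      (∀ m < c k, y m = w m) ∧
      ∃ n, blockEnd d γ b k ≤ n ∧ n < blockEnd d γ b (k + 1) ∧ code y = ξ n ω := by
    intro k w
    by_cases hk : k₀ ≤ k
    · obtain ⟨n, hn1, hn2, y, hy, hyn⟩ := (hk₀ k hk).1 w
      exact ⟨y, fun _ => ⟨hy, n, hn1, hn2, hyn⟩⟩
    · exact ⟨0, fun hk' => absurd hk' hk⟩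
  choose z hz using hz
  obtain ⟨f, hf, hfR, hf0, hfz⟩ := exists_measurable_steering
    (R := remainingLevels θ a b c k₀) (c := c) (b := b) (k₀ := k₀) (z := z)
    (fun j _ k hk hjk => (h.high_le_low hjk).trans (hac k hk)) (fun k hk m hm => hm.2 k hk)
    (fun k hk w => (hz k w hk).1)
  refine le_dimH_of_range_subset hd hf hfR hρ (fun n => le_countBelow_remainingLevels h
    (by linarith) hθ hγ hρ.le hε0.le hεγ hεθ (fun _ => rfl) (fun k hk => (hk₀ k hk).2) n) ?_
  rintro _ ⟨x, rfl⟩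
  refine ⟨mem_iInter.mpr fun i => ?_, f x, fun m hm => ?_, rfl⟩
  · set k := max k₀ i
    obtain ⟨w, hw⟩ := hfz x k (le_max_left _ _)
    obtain ⟨n, hn1, hn2, hn⟩ := (hz k w (le_max_left _ _)).2
    have hin : i ≤ n :=
      (le_max_right k₀ i).trans (((strictMono_blockEnd hd h hγ0).le_apply (x := k)).trans hn1)
    refine mem_iUnion₂.mpr ⟨n, hin, ?_⟩
    rw [Metric.mem_closedBall, ← hn, blockDiameter, blockIndex_eq hd h hγ0 hn1 hn2]
    refine (dist_code_le hw).trans ?_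
    rw [pow_succ, mul_div_right_comm, mul_div_cancel_right₀ _ two_ne_zero]
    gcongr
    exact_mod_cast (Nat.lt_two_pow_self (n := d)).le
  · refine hf0 x m (fun hm' => hm hm'.1) fun k hk hkm => hm (Or.inr ⟨k, ?_, hkm.2⟩)
    exact (hac k hk).trans hkm.1

lemma exists_measurable_range_subset_cantorTorus (d : ℕ) (θ : ℝ) (a b : ℕ → ℕ) :
    ∃ f : (ℕ → Fin d → Fin 2) → ℕ → Fin d → Fin 2, Measurable f ∧
      (∀ x, ∀ m ∈ freeLevels θ a b, f x m = x m) ∧ range (code ∘ f) ⊆ cantorTorus d θ a b := by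
  classical
  refine ⟨fun x m => if m ∈ freeLevels θ a b then x m else 0, ?_, fun x m hm => if_pos hm, ?_⟩
  · refine measurable_pi_lambda _ fun m => ?_
    by_cases hm : m ∈ freeLevels θ a b
    · simpa [hm] using measurable_pi_apply m
    · simp [hm]
  · rintro _ ⟨x, rfl⟩
    exact ⟨_, fun m hm => if_neg hm, rfl⟩

lemma dimH_cantorTorus {d : ℕ} (hd : 1 ≤ d) {θ : ℝ} {a b : ℕ → ℕ} (h : Interlaced a b)
    (h0 : 0 ≤ θ) (h1 : θ ≤ 1) : dimH (cantorTorus d θ a b) = ENNReal.ofReal (d * θ) := by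
  refine le_antisymm (dimH_cantorTorus_le d h h0 h1) ?_
  rcases h0.eq_or_lt with rfl | h0'
  · simp
  obtain ⟨f, hf, hfR, hfr⟩ := exists_measurable_range_subset_cantorTorus d θ a b
  refine le_dimH_of_range_subset hd hf hfR h0' (B := 1) (fun n => ?_) hfr
  rw [mul_comm θ]
  exact le_countBelow_freeLevels h0 h1 n

lemma dimP_cantorTorus {d : ℕ} (hd : 1 ≤ d) {θ : ℝ} {a b : ℕ → ℕ} (h : Interlaced a b) :
    dimP (cantorTorus d θ a b) = d := by
  refine le_antisymm (dimP_le hd _) ?_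
  obtain ⟨f, hf, hfR, hfr⟩ := exists_measurable_range_subset_cantorTorus d θ a b
  refine le_dimP_of_range_subset hf hfR (fun ρ hρ => ?_) hfr
  have hb : Tendsto b atTop atTop := tendsto_atTop_mono (fun k => (h.lt_high k).le) tendsto_id
  refine hb.frequently (Eventually.frequently ?_)
  filter_upwards [h.eventually_low_le (ε := 1 - ρ) (by linarith)] with k hk
  have : ((b k : ℕ) : ℝ) ≤ countBelow (freeLevels θ a b) (b k) + a k := by
    exact_mod_cast le_countBelow_freeLevels_high h k
  linarith

lemma exists_coveringSet_inter_dimH_eq_min (d : ℕ) (hd : 1 ≤ d) (α t : ℝ) (hα0 : 0 ≤ α)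
    (hαd : α ≤ d) (ht0 : 0 ≤ t) (htd : t ≤ d) :
    ∃ (l : ℕ → ℝ) (F : Set (Torus d)),
      IsDiameterSeq l ∧ coveringExponent l = (α : EReal) ∧
      IsClosed F ∧ dimH F = ENNReal.ofReal t ∧ dimP F = (d : ℝ≥0∞) ∧
      ∀ (Ω : Type u) [MeasurableSpace Ω] (P : Measure Ω) [IsProbabilityMeasure P]
        (ξ : ℕ → Ω → Torus d), IsIndepUniform ξ P →
        ∀ᵐ ω ∂P, dimH (coveringSet l ξ ω ∩ F) = ENNReal.ofReal (min α t) := by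
  have hd' : (0:ℝ) < d := by exact_mod_cast hd
  obtain ⟨a, b, h, ha⟩ := exists_interlaced (d + 2)
  have hb : ∀ k, d + 2 ≤ b k := fun k => by
    have := ha k; have := h.two_mul_low k; omega
  obtain ⟨γ, hγ0, hγ1, rfl⟩ : ∃ γ : ℝ, 0 ≤ γ ∧ γ ≤ 1 ∧ α = d * γ :=
    ⟨α / d, by positivity, by rwa [div_le_one hd'], by field_simp⟩
  obtain ⟨θ, hθ0, hθ1, rfl⟩ : ∃ θ : ℝ, 0 ≤ θ ∧ θ ≤ 1 ∧ t = d * θ :=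
    ⟨t / d, by positivity, by rwa [div_le_one hd'], by field_simp⟩
  have hexp := coveringExponent_blockDiameter hd h hγ0 hb
  have hl := isDiameterSeq_blockDiameter hd h hγ0 hb
  refine ⟨blockDiameter d γ b, cantorTorus d θ a b, hl, hexp, isClosed_cantorTorus d θ a b,
    dimH_cantorTorus hd h hθ0 hθ1, dimP_cantorTorus hd h, fun Ω _ P _ ξ hξ => ?_⟩
  have hcb : ∀ k, ⌊γ * b k⌋₊ ≤ b k := fun k => by
    refine Nat.floor_le_of_le ?_
    have : (0:ℝ) ≤ b k := by positivity
    nlinarith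
  filter_upwards [ae_eventually_forall_exists_mem_dyadicCell hξ (c := fun k => ⌊γ * b k⌋₊)
    (N := blockEnd d γ b) (M := fun k => 2 * d * b k) (blockEnd_add_le h hγ0) (fun k => by
      have h1 := Nat.mul_le_mul_left d (hcb k)
      have h2 := Nat.mul_le_mul hd (h.lt_high k).le
      linarith)] with ω hω
  rw [← mul_min_of_nonneg _ _ hd'.le]
  refine le_antisymm ?_ ?_
  · rw [mul_min_of_nonneg _ _ hd'.le, ENNReal.ofReal_min]
    exact le_min ((dimH_mono inter_subset_left).trans
      (dimH_coveringSet_le hl (by positivity) hexp.le ξ ω))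
      ((dimH_mono inter_subset_right).trans (dimH_cantorTorus_le d h hθ0 hθ1))
  · rcases (le_min hγ0 hθ0).eq_or_lt with h0 | h0
    · simp [← h0]
    have hlim : Tendsto (fun ρ : ℝ => ENNReal.ofReal (d * ρ)) (𝓝[<] (min γ θ))
        (𝓝 (ENNReal.ofReal (d * min γ θ))) :=
      (ENNReal.tendsto_ofReal (tendsto_id.const_mul _)).mono_left nhdsWithin_le_nhds
    refine le_of_tendsto hlim ?_
    filter_upwards [Ioo_mem_nhdsLT h0] with ρ hρ
    exact le_dimH_coveringSet_inter_cantorTorus hd h hγ1 hθ1 hρ.1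
      (hρ.2.trans_le (min_le_left _ _)) (hρ.2.trans_le (min_le_right _ _)) hω

theorem proposition4 (d : ℕ) (hd : 1 ≤ d) :
    (∀ α t : ℝ, 0 ≤ α → α ≤ d → 0 ≤ t → t ≤ d →
      ∃ (l : ℕ → ℝ) (F : Set (Torus d)),
        IsDiameterSeq l ∧ coveringExponent l = (α : EReal) ∧
        IsClosed F ∧ dimH F = ENNReal.ofReal t ∧ dimP F = (d : ℝ≥0∞) ∧
        ∀ (Ω : Type u) [MeasurableSpace Ω] (P : Measure Ω) [IsProbabilityMeasure P]
          (ξ : ℕ → Ω → Torus d), IsIndepUniform ξ P →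
          ∀ᵐ ω ∂P, dimH (coveringSet l ξ ω ∩ F) = ENNReal.ofReal (min α t)) ∧
    (∃ (α : ℝ) (l : ℕ → ℝ) (F : Set (Torus d)),
      0 ≤ α ∧ α ≤ d ∧ IsDiameterSeq l ∧ coveringExponent l = (α : EReal) ∧ IsClosed F ∧
      ∀ (Ω : Type u) [MeasurableSpace Ω] (P : Measure Ω) [IsProbabilityMeasure P]
        (ξ : ℕ → Ω → Torus d), IsIndepUniform ξ P →
        ∀ᵐ ω ∂P,
          (dimH F : EReal) + (α : EReal) - (d : EReal)
              < (dimH (coveringSet l ξ ω ∩ F) : EReal) ∧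
          (dimH (coveringSet l ξ ω ∩ F) : EReal)
              < (dimP F : EReal) + (α : EReal) - (d : EReal)) := by
  refine ⟨exists_coveringSet_inter_dimH_eq_min d hd, ?_⟩
  have hd' : (0:ℝ) < d := by exact_mod_cast hd
  -- With `α = d / 2` and `t = 0` the three quantities are `-d / 2`, `0` and `d / 2`.
  obtain ⟨l, F, hl, hexp, hF, hH, hP, hae⟩ := exists_coveringSet_inter_dimH_eq_min.{u} d hd
    (d / 2) 0 (by positivity) (by linarith) le_rfl (by positivity)
  refine ⟨d / 2, l, F, by positivity, by linarith, hl, hexp, hF, fun Ω _ P _ ξ hξ => ?_⟩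
  filter_upwards [hae Ω P ξ hξ] with ω hω
  have e0 : ((ENNReal.ofReal 0 : ℝ≥0∞) : EReal) = ((0 : ℝ) : EReal) := by simp
  have ed : (((d : ℝ≥0∞)) : EReal) = ((d : ℝ) : EReal) := by
    rw [← ENNReal.ofReal_natCast, EReal.coe_ennreal_ofReal, max_eq_left hd'.le]
  have ed' : (d : EReal) = ((d : ℝ) : EReal) := by simp
  rw [hω, hH, hP, min_eq_right (by positivity), e0, ed, ed', ← EReal.coe_add, ← EReal.coe_add,
    ← EReal.coe_sub, ← EReal.coe_sub, EReal.coe_lt_coe_iff, EReal.coe_lt_coe_iff]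
  constructor <;> linarith
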